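/- Let $n \ge 0$ and $k \ge 3$ be integers and let $q \in [1,\infty)$ be a real number with $q > \tfrac n2$. Let $\Omega, \Omega' \subset \mathbb{R}^n$ be bounded domains (nonempty connected open sets) with smooth boundary, and let $\phi : \Omega \to \Omega'$ be a $C^1$-diffeomorphism, i.e. a bijection such that $\phi$ is $C^1$ on $\Omega$ and $\phi^{-1}$ is $C^1$ on $\Omega'$. Suppose that $\phi \in W^{k,q}(\Omega,\Omega')$, i.e. each component of $\phi$ lies in $L^q(\Omega)$ and has all its weak derivatives of order at most $k$ in $L^q(\Omega)$. Then $\phi^{-1} \in W^{k,q}_{\mathrm{loc}}(\Omega',\Omega)$, i.e. each component of $\phi^{-1}$ lies in $W^{k,q}(V)$ for every open set $V$ whose closure is compact and contained in $\Omega'$. -/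

import Mathlib

open MeasureTheory Set Filter Topology
open scoped ContDiff

/-- `Ω` has smooth boundary: near each boundary point, `Ω` is the set where some smooth function
with nonvanishing differential at that point is negative. (By means of a cut-off function, it is
no restriction to take the local defining function defined and smooth on all of `ℝⁿ`.) -/
def HasSmoothBoundary {n : ℕ} (Ω : Set (EuclideanSpace ℝ (Fin n))) : Prop :=
  ∀ x ∈ frontier Ω, ∃ ρ : EuclideanSpace ℝ (Fin n) → ℝ,
    ContDiff ℝ ∞ ρ ∧ fderiv ℝ ρ x ≠ 0 ∧ ∀ᶠ y in 𝓝 x, (y ∈ Ω ↔ ρ y < 0)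

/-- A bounded smooth domain of `ℝⁿ`: a nonempty, connected, bounded open set with smooth
boundary. -/
structure IsBoundedSmoothDomain {n : ℕ} (Ω : Set (EuclideanSpace ℝ (Fin n))) : Prop where
  isOpen : IsOpen Ω
  isConnected : IsConnected Ω
  isBounded : Bornology.IsBounded Ω
  smoothBoundary : HasSmoothBoundary Ω

/-- The classical partial derivative `∂_{α 0} ⋯ ∂_{α (m-1)} η` at `x`, for a multi-index of order
`m` written as the list `α` of the coordinate directions. -/
noncomputable def iteratedPartialDeriv {n m : ℕ} (α : Fin m → Fin n)
    (η : EuclideanSpace ℝ (Fin n) → ℝ) (x : EuclideanSpace ℝ (Fin n)) : ℝ :=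
  iteratedFDeriv ℝ m η x (fun j => EuclideanSpace.single (α j) 1)

/-- `g` is the weak derivative `∂^α u` on the open set `Ω`, where `α` has order `m`:
both functions are locally integrable on `Ω` and
`∫_Ω u ∂^α η = (-1)^m ∫_Ω g η` for all test functions `η ∈ C_c^∞(Ω)`. -/
def HasWeakPartialDeriv {n m : ℕ} (Ω : Set (EuclideanSpace ℝ (Fin n))) (α : Fin m → Fin n)
    (u g : EuclideanSpace ℝ (Fin n) → ℝ) : Prop :=
  LocallyIntegrableOn u Ω ∧ LocallyIntegrableOn g Ω ∧
    ∀ η : EuclideanSpace ℝ (Fin n) → ℝ,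
      ContDiff ℝ ∞ η → HasCompactSupport η → tsupport η ⊆ Ω →
        ∫ x in Ω, u x * iteratedPartialDeriv α η x = (-1 : ℝ) ^ m * ∫ x in Ω, g x * η x

/-- `u ∈ W^{k,q}(Ω)`, for an open set `Ω` and `1 ≤ q < ∞`: `u ∈ L^q(Ω)`, and all weak derivatives
of `u` of order at most `k` exist on `Ω` and belong to `L^q(Ω)`. -/
def MemSobolev {n : ℕ} (k : ℕ) (q : ℝ) (Ω : Set (EuclideanSpace ℝ (Fin n)))
    (u : EuclideanSpace ℝ (Fin n) → ℝ) : Prop :=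
  MemLp u (ENNReal.ofReal q) (volume.restrict Ω) ∧
    ∀ m ≤ k, ∀ α : Fin m → Fin n, ∃ g : EuclideanSpace ℝ (Fin n) → ℝ,
      HasWeakPartialDeriv Ω α u g ∧ MemLp g (ENNReal.ofReal q) (volume.restrict Ω)

/-- `u ∈ W^{k,q}_loc(Ω)`: `u ∈ W^{k,q}(V)` for all open `V ⊂⊂ Ω`. -/
def MemSobolevLoc {n : ℕ} (k : ℕ) (q : ℝ) (Ω : Set (EuclideanSpace ℝ (Fin n)))
    (u : EuclideanSpace ℝ (Fin n) → ℝ) : Prop :=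
  ∀ V : Set (EuclideanSpace ℝ (Fin n)),
    IsOpen V → IsCompact (closure V) → closure V ⊆ Ω → MemSobolev k q V u

/-- `f ∈ W^{k,q}(Ω, Ω')`: `f` maps `Ω` into `Ω'` and its components belong to `W^{k,q}(Ω)`. -/
def MemSobolevMap {n d : ℕ} (k : ℕ) (q : ℝ) (Ω : Set (EuclideanSpace ℝ (Fin n)))
    (Ω' : Set (EuclideanSpace ℝ (Fin d)))
    (f : EuclideanSpace ℝ (Fin n) → EuclideanSpace ℝ (Fin d)) : Prop :=
  MapsTo f Ω Ω' ∧ ∀ i, MemSobolev k q Ω (fun x => f x i)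

/-- `f ∈ W^{k,q}_loc(Ω, Ω')`: `f` maps `Ω` into `Ω'` and its components belong to
`W^{k,q}_loc(Ω)`. -/
def MemSobolevMapLoc {n d : ℕ} (k : ℕ) (q : ℝ) (Ω : Set (EuclideanSpace ℝ (Fin n)))
    (Ω' : Set (EuclideanSpace ℝ (Fin d)))
    (f : EuclideanSpace ℝ (Fin n) → EuclideanSpace ℝ (Fin d)) : Prop :=
  MapsTo f Ω Ω' ∧ ∀ i, MemSobolevLoc k q Ω (fun x => f x i)

/-- The partial homeomorphism `φ` of `ℝⁿ` is a `C¹`-diffeomorphism from the open set `Ω` onto the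
open set `Ω'`; its inverse is `φ.symm`. -/
structure IsC1Diffeomorphism {n : ℕ}
    (φ : OpenPartialHomeomorph (EuclideanSpace ℝ (Fin n)) (EuclideanSpace ℝ (Fin n)))
    (Ω Ω' : Set (EuclideanSpace ℝ (Fin n))) : Prop where
  source_eq : φ.source = Ω
  target_eq : φ.target = Ω'
  contDiffOn : ContDiffOn ℝ 1 φ Ω
  contDiffOn_symm : ContDiffOn ℝ 1 φ.symm Ω'

/-! Write ψ = φ⁻¹. On Ω' one has Dψ = (Dφ)⁻¹ ∘ ψ, so by Cramer's rule the entries of Dψ are those of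
adj(Dφ) / det(Dφ), composed with ψ. If Dψ has j orders of weak derivatives, then composition with ψ
preserves j + 1 orders, because the chain rule spends one derivative before Dψ enters. So the
regularity of Dψ can be bootstrapped from mere continuity up to that of Dφ
(`weakDiff_partialDeriv_symm`).

The difficulty is the integrability of the products that arise. Put M = k - 1 and give the
derivatives of φ of order a + 1 the weight a. Locally, weights up to M - 2 are in L^∞ by the
embedding of W^{2,q}, which is where q > n/2 enters (`memLpLoc_top_of_hasWeakDeriv`); weight M is in
L^q; weight M - 1 is in L^{2q}, by Gagliardo–Nirenberg interpolation between L^∞ and L^q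
(`memLpLoc_two_mul_of_hasWeakDeriv`). With these exponents Hölder's inequality makes weights
additive up to the total M (`isExponentFamily_sobolevExponent`); k ≥ 3 ensures that weight 0 means
L^∞. Consequently the classes `WeakDiff` are stable under products, and in weight 0 under
determinants and reciprocals of nonvanishing continuous functions; composition with ψ is handled by
`WeakDiff.comp_symm`.

The underlying calculus rests on mollification. The chain rule for C¹ functions with bounded
derivative gives, by truncation and polarization, the product rule under minimal integrability
(`HasWeakDeriv.mul`). The Sobolev inequality comes from averaging a second order Taylor formula over
a ball (`exists_enorm_le_sobolev`), the interpolation inequality from one integration by parts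
(`integral_partialDeriv_rpow_le`). -/

namespace SobolevInverse

/-! ### Test functions and first order weak derivatives -/

/-- The Euclidean space `ℝⁿ`. -/
abbrev Euc (n : ℕ) := EuclideanSpace ℝ (Fin n)

/-- The classical partial derivative in the direction of the `i`-th coordinate. -/
noncomputable def partialDeriv {n : ℕ} (i : Fin n) (η : Euc n → ℝ) (x : Euc n) : ℝ :=
  fderiv ℝ η x (EuclideanSpace.single i 1)

/-- Smooth functions with compact support in `Ω`. -/
structure IsTestFunction {n : ℕ} (Ω : Set (Euc n)) (η : Euc n → ℝ) : Prop where
  contDiff : ContDiff ℝ ∞ η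
  hasCompactSupport : HasCompactSupport η
  tsupport_subset : tsupport η ⊆ Ω

/-- `g` is the weak derivative of `u` on `Ω` in the direction of the `i`-th coordinate. -/
structure HasWeakDeriv {n : ℕ} (Ω : Set (Euc n)) (i : Fin n) (u g : Euc n → ℝ) : Prop where
  left : LocallyIntegrableOn u Ω
  right : LocallyIntegrableOn g Ω
  integral_eq : ∀ η, IsTestFunction Ω η → ∫ x, u x * partialDeriv i η x = -∫ x, g x * η x

variable {n : ℕ} {Ω Ω' : Set (Euc n)} {i : Fin n}

lemma partialDeriv_contDiff {η : Euc n → ℝ} (h : ContDiff ℝ ∞ η) :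
    ContDiff ℝ ∞ (partialDeriv i η) :=
  (h.fderiv_right (m := ∞) (by simp)).clm_apply contDiff_const

lemma tsupport_partialDeriv_subset (η : Euc n → ℝ) :
    tsupport (partialDeriv i η) ⊆ tsupport η := by
  refine (closure_mono ?_).trans (tsupport_fderiv_subset ℝ (f := η))
  intro x hx h
  exact hx (by simp [partialDeriv, h])

lemma partialDeriv_eq_of_eventuallyEq {η ζ : Euc n → ℝ} {x : Euc n} (h : η =ᶠ[𝓝 x] ζ) :
    partialDeriv i η x = partialDeriv i ζ x := by
  simp [partialDeriv, h.fderiv_eq]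

lemma partialDeriv_mul {η ζ : Euc n → ℝ} {x : Euc n} (h : DifferentiableAt ℝ η x)
    (h' : DifferentiableAt ℝ ζ x) :
    partialDeriv i (fun y => η y * ζ y) x =
      partialDeriv i η x * ζ x + η x * partialDeriv i ζ x := by
  simp only [partialDeriv]
  rw [fderiv_fun_mul h h']
  simp
  ring

namespace IsTestFunction

variable {η : Euc n → ℝ}

lemma continuous (h : IsTestFunction Ω η) : Continuous η := h.contDiff.continuous

lemma differentiable (h : IsTestFunction Ω η) : Differentiable ℝ η :=
  h.contDiff.differentiable (by simp)

lemma contDiff_one (h : IsTestFunction Ω η) : ContDiff ℝ 1 η := h.contDiff.of_le (by simp)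

lemma partialDeriv (h : IsTestFunction Ω η) (i : Fin n) :
    IsTestFunction Ω (partialDeriv i η) where
  contDiff := partialDeriv_contDiff h.contDiff
  hasCompactSupport := h.hasCompactSupport.of_isClosed_subset (isClosed_tsupport _)
    (tsupport_partialDeriv_subset η)
  tsupport_subset := (tsupport_partialDeriv_subset η).trans h.tsupport_subset

lemma mono (h : IsTestFunction Ω η) (hΩ : Ω ⊆ Ω') : IsTestFunction Ω' η :=
  ⟨h.contDiff, h.hasCompactSupport, h.tsupport_subset.trans hΩ⟩

lemma mul_left (h : IsTestFunction Ω η) {χ : Euc n → ℝ} (hχ : ContDiff ℝ ∞ χ) :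
    IsTestFunction Ω (fun x => χ x * η x) where
  contDiff := hχ.mul h.contDiff
  hasCompactSupport := h.hasCompactSupport.mul_left
  tsupport_subset := (closure_mono (Function.support_mul_subset_right χ η)).trans h.tsupport_subset

lemma zero_of_notMem (h : IsTestFunction Ω η) {x : Euc n} (hx : x ∉ Ω) : η x = 0 :=
  image_eq_zero_of_notMem_tsupport fun h' => hx (h.tsupport_subset h')

lemma exists_bound (h : IsTestFunction Ω η) : ∃ C, 0 ≤ C ∧ ∀ x, |η x| ≤ C := by
  obtain ⟨C, hC⟩ := h.continuous.bounded_above_of_compact_support h.hasCompactSupport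
  exact ⟨C, (norm_nonneg _).trans (hC 0), hC⟩

end IsTestFunction

/-- The product of a locally integrable function and a continuous function with compact support
is integrable. -/
lemma integrable_mul_of_tsupport_subset {f η : Euc n → ℝ} (hf : LocallyIntegrableOn f Ω)
    (hη : ContinuousOn η (tsupport η)) (hc : HasCompactSupport η) (hs : tsupport η ⊆ Ω) :
    Integrable (fun x => f x * η x) := by
  have h1 : IntegrableOn f (tsupport η) := hf.integrableOn_compact_subset hs hc
  have h2 : IntegrableOn (fun x => f x * η x) (tsupport η) :=
    h1.mul_continuousOn hη hc
  rw [← integrableOn_univ]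
  refine h2.of_forall_sdiff_eq_zero MeasurableSet.univ fun x hx => ?_
  simp [image_eq_zero_of_notMem_tsupport hx.2]

lemma IsTestFunction.integrable_mul {f η : Euc n → ℝ} (h : IsTestFunction Ω η)
    (hf : LocallyIntegrableOn f Ω) : Integrable (fun x => f x * η x) :=
  integrable_mul_of_tsupport_subset hf h.continuous.continuousOn h.hasCompactSupport
    h.tsupport_subset

/-- Smooth cut-off functions. -/
lemma exists_cutoff (hΩ : IsOpen Ω) {K : Set (Euc n)} (hK : IsCompact K) (hKΩ : K ⊆ Ω) :
    ∃ χ : Euc n → ℝ, IsTestFunction Ω χ ∧ ∀ᶠ x in 𝓝ˢ K, χ x = 1 := by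
  obtain ⟨L, hL, hKL, hLΩ⟩ := exists_compact_between hK hΩ hKΩ
  obtain ⟨f, h1, h0, -⟩ := exists_contMDiffMap_one_nhds_of_subset_interior (n := (⊤ : ℕ∞))
    (modelWithCornersSelf ℝ (Euc n)) hK.isClosed hKL
  have hsupp : tsupport (f : Euc n → ℝ) ⊆ L :=
    closure_minimal (fun x hx => by_contra fun h => hx (h0 x h)) hL.isClosed
  exact ⟨f, ⟨f.contMDiff.contDiff, hL.of_isClosed_subset (isClosed_tsupport _) hsupp,
    hsupp.trans hLΩ⟩, h1⟩

lemma locallyIntegrableOn_of_forall_isCompact (hΩ : IsOpen Ω) {f : Euc n → ℝ}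
    (h : ∀ K ⊆ Ω, IsCompact K → IntegrableOn f K) : LocallyIntegrableOn f Ω :=
  (locallyIntegrableOn_iff hΩ.isLocallyClosed).2 h

lemma integral_mul_congr_ae {f g η : Euc n → ℝ} (hΩ : IsOpen Ω)
    (hfg : f =ᵐ[volume.restrict Ω] g) (hη : ∀ x ∉ Ω, η x = 0) :
    ∫ x, f x * η x = ∫ x, g x * η x := by
  refine integral_congr_ae ?_
  filter_upwards [(ae_restrict_iff' hΩ.measurableSet).1 hfg] with x hx
  by_cases h : x ∈ Ω
  · rw [hx h]
  · simp [hη x h]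

/-! ### Elementary properties of weak derivatives -/

namespace HasWeakDeriv

variable {u v g h : Euc n → ℝ}

lemma congr_ae (H : HasWeakDeriv Ω i u g) (hΩ : IsOpen Ω) (huv : u =ᵐ[volume.restrict Ω] v)
    (hgh : g =ᵐ[volume.restrict Ω] h) : HasWeakDeriv Ω i v h where
  left := LocallyIntegrableOn.congr huv H.left
  right := LocallyIntegrableOn.congr hgh H.right
  integral_eq η hη := by
    rw [← integral_mul_congr_ae hΩ huv fun x hx => (hη.partialDeriv i).zero_of_notMem hx,
      ← integral_mul_congr_ae hΩ hgh fun x hx => hη.zero_of_notMem hx, H.integral_eq η hη]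

lemma add (H : HasWeakDeriv Ω i u g) (H' : HasWeakDeriv Ω i v h) :
    HasWeakDeriv Ω i (fun x => u x + v x) (fun x => g x + h x) where
  left := H.left.add H'.left
  right := H.right.add H'.right
  integral_eq η hη := by
    simp only [add_mul]
    rw [integral_add ((hη.partialDeriv i).integrable_mul H.left)
      ((hη.partialDeriv i).integrable_mul H'.left), integral_add (hη.integrable_mul H.right)
      (hη.integrable_mul H'.right), H.integral_eq η hη, H'.integral_eq η hη]
    ring

lemma const_mul (H : HasWeakDeriv Ω i u g) (c : ℝ) :
    HasWeakDeriv Ω i (fun x => c * u x) (fun x => c * g x) where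
  left := H.left.smul c
  right := H.right.smul c
  integral_eq η hη := by
    simp only [mul_assoc]
    rw [integral_const_mul, integral_const_mul, H.integral_eq η hη]
    ring

lemma mono (H : HasWeakDeriv Ω i u g) (h : Ω' ⊆ Ω) : HasWeakDeriv Ω' i u g where
  left := H.left.mono_set h
  right := H.right.mono_set h
  integral_eq η hη := H.integral_eq η (hη.mono h)

/-- Multiplication by a test function extends a weakly differentiable function to the whole
space. -/
lemma testFunction_mul {χ : Euc n → ℝ} (H : HasWeakDeriv Ω i u g) (hχ : IsTestFunction Ω χ) :
    HasWeakDeriv univ i (fun x => χ x * u x) (fun x => partialDeriv i χ x * u x + χ x * g x) where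
  left := by
    simpa [mul_comm] using (hχ.integrable_mul H.left).locallyIntegrable.locallyIntegrableOn univ
  right := by
    have := (((hχ.partialDeriv i).integrable_mul H.left).add
      (hχ.integrable_mul H.right)).locallyIntegrable.locallyIntegrableOn univ
    refine this.congr (ae_of_all _ fun x => ?_)
    simp [mul_comm]
  integral_eq η hη := by
    have hηχ : IsTestFunction Ω (fun x => η x * χ x) := hχ.mul_left hη.contDiff
    have h1 := H.integral_eq _ hηχ
    have h2 : ∀ x, u x * partialDeriv i (fun x => η x * χ x) x =
        χ x * u x * partialDeriv i η x + partialDeriv i χ x * u x * η x := fun x => by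
      rw [partialDeriv_mul hη.differentiable.differentiableAt hχ.differentiable.differentiableAt]
      ring
    simp only [h2] at h1
    have e1 : Integrable (fun x => χ x * u x * partialDeriv i η x) := by
      convert! (hχ.mul_left (hη.partialDeriv i).contDiff).integrable_mul H.left using 2
      ring
    have e2 : Integrable (fun x => partialDeriv i χ x * u x * η x) := by
      convert! ((hχ.partialDeriv i).mul_left hη.contDiff).integrable_mul H.left using 2
      ring
    have e3 : Integrable (fun x => χ x * g x * η x) := by
      convert! (hχ.mul_left hη.contDiff).integrable_mul H.right using 2
      ring
    rw [integral_add e1 e2] at h1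
    simp only [add_mul]
    rw [integral_add e2 e3, eq_sub_of_add_eq h1]
    have : ∀ x, g x * (η x * χ x) = χ x * g x * η x := fun x => by ring
    simp only [this]
    ring

/-- A classical continuous derivative is a weak derivative. -/
lemma of_contDiffOn (hΩ : IsOpen Ω) (hu : ContDiffOn ℝ 1 u Ω) :
    HasWeakDeriv Ω i u (partialDeriv i u) := by
  have hu' : ContinuousOn (partialDeriv i u) Ω :=
    (hu.continuousOn_fderiv_of_isOpen hΩ le_rfl).clm_apply continuousOn_const
  have L1 : LocallyIntegrableOn u Ω := hu.continuousOn.locallyIntegrableOn hΩ.measurableSet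
  have L2 : LocallyIntegrableOn (partialDeriv i u) Ω := hu'.locallyIntegrableOn hΩ.measurableSet
  refine ⟨L1, L2, fun η hη => ?_⟩
  exact integral_mul_fderiv_eq_neg_fderiv_mul_of_integrable (hη.integrable_mul L2)
    ((hη.partialDeriv i).integrable_mul L1) (hη.integrable_mul L1)
    (fun x hx => (hu.differentiableOn one_ne_zero).differentiableAt
      (hΩ.mem_nhds (hη.tsupport_subset hx)))
    (fun x _ => hη.differentiable.differentiableAt)

/-- Weak derivatives are unique. -/
lemma unique (hΩ : IsOpen Ω) (H : HasWeakDeriv Ω i u g) (H' : HasWeakDeriv Ω i u h) :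
    g =ᵐ[volume.restrict Ω] h := by
  have := hΩ.ae_eq_zero_of_integral_contDiff_smul_eq_zero (μ := volume)
    (f := fun x => g x - h x) (H.right.sub H'.right) fun η h1 h2 h3 => by
      have hη : IsTestFunction Ω η := ⟨h1, h2, h3⟩
      have e := (H.integral_eq η hη).symm.trans (H'.integral_eq η hη)
      have : ∀ x, η x • (g x - h x) = g x * η x - h x * η x := fun x => by
        rw [smul_eq_mul]; ring
      simp only [this]
      rw [integral_sub (hη.integrable_mul H.right) (hη.integrable_mul H'.right)]
      linarith
  refine (ae_restrict_iff' hΩ.measurableSet).2 ?_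
  filter_upwards [this] with x hx hxΩ
  linarith [hx hxΩ]

/-- Weak derivatives pass to dominated pointwise limits. -/
lemma of_tendsto {us gs : ℕ → Euc n → ℝ} {U G : Euc n → ℝ} (hΩ : IsOpen Ω)
    (H : ∀ m, HasWeakDeriv Ω i (us m) (gs m))
    (hU : LocallyIntegrableOn U Ω) (hG : LocallyIntegrableOn G Ω)
    (bU : ∀ m, ∀ᵐ x ∂volume.restrict Ω, |us m x| ≤ U x)
    (bG : ∀ m, ∀ᵐ x ∂volume.restrict Ω, |gs m x| ≤ G x)
    (lu : ∀ᵐ x ∂volume.restrict Ω, Tendsto (fun m => us m x) atTop (𝓝 (u x)))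
    (lg : ∀ᵐ x ∂volume.restrict Ω, Tendsto (fun m => gs m x) atTop (𝓝 (g x))) :
    HasWeakDeriv Ω i u g := by
  -- Both sides of the defining identity are pairings with a test function, so one dominated
  -- convergence statement serves for `us` and for `gs`.
  have key : ∀ {fs : ℕ → Euc n → ℝ} {f F : Euc n → ℝ}, (∀ m, LocallyIntegrableOn (fs m) Ω) →
      LocallyIntegrableOn F Ω → (∀ m, ∀ᵐ x ∂volume.restrict Ω, |fs m x| ≤ F x) →
      (∀ᵐ x ∂volume.restrict Ω, Tendsto (fun m => fs m x) atTop (𝓝 (f x))) →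
      LocallyIntegrableOn f Ω ∧ ∀ η, IsTestFunction Ω η →
        Tendsto (fun m => ∫ x, fs m x * η x) atTop (𝓝 (∫ x, f x * η x)) := by
    intro fs f F h1 h2 h3 h4
    constructor
    · refine locallyIntegrableOn_of_forall_isCompact hΩ fun K hK hKc => ?_
      have a3 := fun m => ae_restrict_of_ae_restrict_of_subset hK (h3 m)
      have a4 := ae_restrict_of_ae_restrict_of_subset hK h4
      refine (h2.integrableOn_compact_subset hK hKc).mono'
        (aestronglyMeasurable_of_tendsto_ae atTop
          (fun m => ((h1 m).integrableOn_compact_subset hK hKc).aestronglyMeasurable) a4) ?_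
      filter_upwards [ae_all_iff.2 a3, a4] with x hx hx'
      exact le_of_tendsto hx'.abs (Eventually.of_forall hx)
    · intro η hη
      refine tendsto_integral_of_dominated_convergence (fun x => |F x * η x|)
        (fun m => (hη.integrable_mul (h1 m)).aestronglyMeasurable) (hη.integrable_mul h2).abs ?_ ?_
      · intro m
        filter_upwards [(ae_restrict_iff' hΩ.measurableSet).1 (h3 m)] with x hx
        by_cases hxΩ : x ∈ Ω
        · rw [Real.norm_eq_abs, abs_mul, abs_mul]
          exact mul_le_mul_of_nonneg_right ((hx hxΩ).trans (le_abs_self _)) (abs_nonneg _)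
        · simp [hη.zero_of_notMem hxΩ]
      · filter_upwards [(ae_restrict_iff' hΩ.measurableSet).1 h4] with x hx
        by_cases hxΩ : x ∈ Ω
        · exact (hx hxΩ).mul_const _
        · simp [hη.zero_of_notMem hxΩ]
  obtain ⟨l1, c1⟩ := key (fun m => (H m).left) hU bU lu
  obtain ⟨l2, c2⟩ := key (fun m => (H m).right) hG bG lg
  refine ⟨l1, l2, fun η hη => tendsto_nhds_unique (c1 _ (hη.partialDeriv i)) ?_⟩
  simp only [(H _).integral_eq η hη]
  exact (c2 η hη).neg

lemma zero : HasWeakDeriv Ω i (fun _ => 0) (fun _ => 0) :=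
  ⟨locallyIntegrableOn_zero, locallyIntegrableOn_zero, fun η _ => by simp⟩

end HasWeakDeriv

/-! ### Mollification -/

open scoped Convolution ENNReal

/-- A sequence of bump functions shrinking to the origin. -/
noncomputable def bump (n m : ℕ) : ContDiffBump (0 : Euc n) where
  rIn := 1 / ((m : ℝ) + 1) / 2
  rOut := 1 / ((m : ℝ) + 1)
  rIn_pos := by positivity
  rIn_lt_rOut := half_lt_self (by positivity)

/-- The mollification of `f` at scale `1 / (m + 1)`. -/
noncomputable def mollify (m : ℕ) (f : Euc n → ℝ) : Euc n → ℝ :=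
  (bump n m).normed volume ⋆[ContinuousLinearMap.lsmul ℝ ℝ, volume] f

lemma mollify_apply (m : ℕ) (f : Euc n → ℝ) (x : Euc n) :
    mollify m f x = ∫ t, (bump n m).normed volume t * f (x - t) := by
  simp [mollify, convolution_def]

lemma mollify_apply_swap (m : ℕ) (f : Euc n → ℝ) (x : Euc n) :
    mollify m f x = ∫ t, f t * (bump n m).normed volume (x - t) := by
  simp [mollify, convolution_eq_swap, mul_comm]

lemma mollify_congr_ae {m : ℕ} {f g : Euc n → ℝ} (h : f =ᵐ[volume] g) :
    mollify m f = mollify m g :=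
  convolution_congr _ EventuallyEq.rfl h

lemma contDiff_mollify (m : ℕ) {f : Euc n → ℝ} (hf : LocallyIntegrable f) :
    ContDiff ℝ ∞ (mollify m f) :=
  ((bump n m).hasCompactSupport_normed (μ := volume)).contDiff_convolution_left
    (ContinuousLinearMap.lsmul ℝ ℝ) (n := (⊤ : ℕ∞)) (bump n m).contDiff_normed hf

lemma hasCompactSupport_mollify (m : ℕ) {f : Euc n → ℝ} (hf : HasCompactSupport f) :
    HasCompactSupport (mollify m f) :=
  ((bump n m).hasCompactSupport_normed (μ := volume)).convolution _ hf

lemma mollify_sub (m : ℕ) {f g : Euc n → ℝ} (hf : LocallyIntegrable f) (hg : LocallyIntegrable g) :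
    mollify m (f - g) = mollify m f - mollify m g := by
  have h := fun {f : Euc n → ℝ} (hf : LocallyIntegrable f) =>
    ((bump n m).hasCompactSupport_normed (μ := volume)).convolutionExists_left
      (ContinuousLinearMap.lsmul ℝ ℝ) (bump n m).continuous_normed hf
  ext x
  simp only [mollify_apply, Pi.sub_apply, mul_sub]
  exact integral_sub (h hf x) (h hg x)

lemma isTestFunction_bump (m : ℕ) (x : Euc n) :
    IsTestFunction univ (fun t => (bump n m).normed volume (x - t)) where
  contDiff := (bump n m).contDiff_normed.comp (contDiff_const.sub contDiff_id)
  hasCompactSupport :=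
    (bump n m).hasCompactSupport_normed.comp_homeomorph (Homeomorph.subLeft x)
  tsupport_subset := subset_univ _

/-- The classical derivative falls on the kernel, and t ↦ ρ(x - t) is itself a test function. The
sign from differentiating in t instead of x cancels the sign in the definition of the weak
derivative. -/
lemma partialDeriv_mollify (m : ℕ) {f g : Euc n → ℝ} (H : HasWeakDeriv univ i f g) :
    partialDeriv i (mollify m f) = mollify m g := by
  have hf : LocallyIntegrable f := locallyIntegrableOn_univ.1 H.left
  ext x
  have h1 := ((bump n m).hasCompactSupport_normed (μ := volume)).hasFDerivAt_convolution_left (μ := volume)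
    (ContinuousLinearMap.lsmul ℝ ℝ) ((bump n m).contDiff_normed (n := 1)) hf x
  have h2 := ((bump n m).hasCompactSupport_normed (μ := volume)).fderiv (𝕜 := ℝ)
    |>.convolutionExists_left (ContinuousLinearMap.precompL (Euc n) (ContinuousLinearMap.lsmul ℝ ℝ))
      (((bump n m).contDiff_normed (n := 1)).continuous_fderiv one_ne_zero) hf x
  rw [partialDeriv, mollify, h1.fderiv, mollify_apply_swap]
  rw [convolution_eq_swap, ContinuousLinearMap.integral_apply]
  · have h3 := H.integral_eq _ (isTestFunction_bump m x)
    rw [← neg_eq_iff_eq_neg] at h3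
    rw [← h3, ← integral_neg]
    refine integral_congr_ae (ae_of_all _ fun t => ?_)
    have h4 : HasFDerivAt (fun t => (bump n m).normed volume (x - t))
        (-(fderiv ℝ ((bump n m).normed volume) (x - t))) t := by
      have := (((bump n m).contDiff_normed (μ := volume) (n := 1)).differentiable one_ne_zero
        (x - t)).hasFDerivAt.comp t ((hasFDerivAt_id t).const_sub x)
      convert! this using 1
      ext; simp
    simp [partialDeriv, h4.fderiv, mul_comm]
  · exact h2.integrable_swap

lemma ae_tendsto_mollify {f : Euc n → ℝ} (hf : LocallyIntegrable f) :
    ∀ᵐ x, Tendsto (fun m => mollify m f x) atTop (𝓝 (f x)) := by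
  -- The outer radius of each bump is exactly twice the inner one, so the ratio stays bounded as the
  -- bumps shrink.
  refine ContDiffBump.ae_convolution_tendsto_right_of_locallyIntegrable (K := 2)
    tendsto_one_div_add_atTop_nhds_zero_nat (Eventually.of_forall fun m => ?_) hf
  simp only [bump]
  linarith

/-- The probability measure with density a normed bump function. -/
noncomputable def bumpMeasure (n m : ℕ) : Measure (Euc n) :=
  volume.withDensity fun t => ENNReal.ofReal ((bump n m).normed volume t)

instance (m : ℕ) : IsProbabilityMeasure (bumpMeasure n m) := by
  constructor
  rw [bumpMeasure, withDensity_apply _ MeasurableSet.univ, Measure.restrict_univ,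
    ← ofReal_integral_eq_lintegral_ofReal (bump n m).integrable_normed
      (ae_of_all _ (bump n m).nonneg_normed), (bump n m).integral_normed, ENNReal.ofReal_one]

lemma enorm_mollify_le (m : ℕ) {f : Euc n → ℝ} (x : Euc n) :
    ‖mollify m f x‖ₑ ≤ ∫⁻ t, ‖f (x - t)‖ₑ ∂bumpMeasure n m := by
  rw [mollify_apply, bumpMeasure, lintegral_withDensity_eq_lintegral_mul_non_measurable _
    (bump n m).continuous_normed.measurable.ennreal_ofReal (by simp)]
  refine (enorm_integral_le_lintegral_enorm _).trans_eq (lintegral_congr fun t => ?_)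
  rw [enorm_mul, Pi.mul_apply, Real.enorm_eq_ofReal ((bump n m).nonneg_normed t)]

/-- Mollification does not increase the `L^p` norm. -/
lemma lintegral_mollify_rpow_le (m : ℕ) {f : Euc n → ℝ} (hf : AEStronglyMeasurable f) {p : ℝ}
    (hp : 1 ≤ p) : ∫⁻ x, ‖mollify m f x‖ₑ ^ p ≤ ∫⁻ x, ‖f x‖ₑ ^ p := by
  -- A measurable representative makes (x, t) ↦ f (x - t) jointly measurable, as Tonelli requires
  -- below.
  wlog hfm : StronglyMeasurable f generalizing f
  · rw [mollify_congr_ae hf.ae_eq_mk]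
    refine (this hf.stronglyMeasurable_mk.aestronglyMeasurable hf.stronglyMeasurable_mk).trans_eq ?_
    refine lintegral_congr_ae ?_
    filter_upwards [hf.ae_eq_mk] with x hx
    rw [hx]
  have hp0 : 0 < p := by linarith
  have hmeas : Measurable (fun z : Euc n × Euc n => ‖f (z.1 - z.2)‖ₑ ^ p) :=
    ((hfm.measurable.comp (measurable_fst.sub measurable_snd)).enorm).pow_const p
  -- Jensen's inequality in the form that L^p norms over a probability measure increase with p.
  have jensen : ∀ x, ‖mollify m f x‖ₑ ^ p ≤ ∫⁻ t, ‖f (x - t)‖ₑ ^ p ∂bumpMeasure n m := fun x => by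
    have h := eLpNorm'_le_eLpNorm'_of_exponent_le (μ := bumpMeasure n m) one_pos hp
      (f := fun t => f (x - t))
      ((hfm.measurable.comp (measurable_const.sub measurable_id)).aestronglyMeasurable)
    simp only [eLpNorm', ENNReal.rpow_one, div_one] at h
    calc ‖mollify m f x‖ₑ ^ p ≤ ((∫⁻ t, ‖f (x - t)‖ₑ ^ p ∂bumpMeasure n m) ^ (1 / p)) ^ p := by
          gcongr
          exact (enorm_mollify_le m x).trans h
      _ = _ := by rw [← ENNReal.rpow_mul, one_div_mul_cancel hp0.ne', ENNReal.rpow_one]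
  calc ∫⁻ x, ‖mollify m f x‖ₑ ^ p
      ≤ ∫⁻ x, ∫⁻ t, ‖f (x - t)‖ₑ ^ p ∂bumpMeasure n m := lintegral_mono jensen
    _ = ∫⁻ t, (∫⁻ x, ‖f (x - t)‖ₑ ^ p) ∂bumpMeasure n m := lintegral_lintegral_swap hmeas.aemeasurable
    _ = ∫⁻ t, (∫⁻ x, ‖f x‖ₑ ^ p) ∂bumpMeasure n m := by
        refine lintegral_congr fun t => ?_
        exact lintegral_sub_right_eq_self (fun x => ‖f x‖ₑ ^ p) t
    _ = ∫⁻ x, ‖f x‖ₑ ^ p := by simp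

lemma abs_mollify_le (m : ℕ) {f : Euc n → ℝ} {C : ℝ} (hC : ∀ᵐ x, |f x| ≤ C) (x : Euc n) :
    |mollify m f x| ≤ C := by
  rw [mollify_apply]
  have h1 : ∀ᵐ t, |f (x - t)| ≤ C :=
    (Measure.measurePreserving_sub_left volume x).quasiMeasurePreserving.ae hC
  calc |∫ t, (bump n m).normed volume t * f (x - t)|
      ≤ ∫ t, (bump n m).normed volume t * C := by
        rw [← Real.norm_eq_abs]
        refine norm_integral_le_of_norm_le (((bump n m).integrable_normed (μ := volume)).mul_const C) ?_
        filter_upwards [h1] with t ht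
        rw [norm_mul, Real.norm_of_nonneg ((bump n m).nonneg_normed t)]
        exact mul_le_mul_of_nonneg_left ht ((bump n m).nonneg_normed t)
    _ = C := by rw [integral_mul_const, (bump n m).integral_normed, one_mul]

lemma lintegral_enorm_mollify_le (m : ℕ) {f : Euc n → ℝ} (hf : Integrable f) :
    ∫⁻ x, ‖mollify m f x‖ₑ ≤ ∫⁻ x, ‖f x‖ₑ := by
  simpa using lintegral_mollify_rpow_le m hf.aestronglyMeasurable le_rfl

/-- Dominated convergence: all bumps have radius at most 1, so the differences vanish off the closed
1-neighbourhood of the support, which is compact, and on it they are at most twice the sup of |f|.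
-/
lemma tendsto_lintegral_mollify_sub_of_continuous {f : Euc n → ℝ} (hf : Continuous f)
    (hc : HasCompactSupport f) :
    Tendsto (fun m => ∫⁻ x, ‖mollify m f x - f x‖ₑ) atTop (𝓝 0) := by
  obtain ⟨C, hC⟩ := hf.bounded_above_of_compact_support hc
  set K := Metric.cthickening 1 (tsupport f) with hK
  have hKc : IsCompact K := hc.cthickening
  have hlim := tendsto_lintegral_of_dominated_convergence' (μ := (volume : Measure (Euc n)))
    (F := fun m x => ‖mollify m f x - f x‖ₑ)
    (f := fun _ => 0) (K.indicator fun _ => ENNReal.ofReal (C + C)) (fun m => ?_) (fun m => ?_) ?_ ?_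
  · simpa using hlim
  · exact (((contDiff_mollify m hf.locallyIntegrable).continuous.sub hf).measurable.enorm).aemeasurable
  · refine ae_of_all _ fun x => ?_
    by_cases hx : x ∈ K
    · simp only [indicator_of_mem hx, Real.enorm_eq_ofReal_abs]
      refine ENNReal.ofReal_le_ofReal ((abs_sub _ _).trans ?_)
      exact add_le_add (abs_mollify_le m (ae_of_all _ hC) x) (hC x)
    · have hz : ∀ y ∈ Metric.closedBall x 1, f y = 0 := fun y hy => by
        refine image_eq_zero_of_notMem_tsupport fun h => hx ?_
        exact Metric.mem_cthickening_of_dist_le x y 1 _ h (by rwa [dist_comm])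
      have h0 : f x = 0 := hz x (by simp)
      have : mollify m f x = f x := (bump n m).normed_convolution_eq_right (g := f) fun y hy => by
        rw [h0]
        refine hz y (Metric.ball_subset_closedBall (Metric.ball_subset_ball ?_ hy))
        simp only [bump]
        rw [div_le_one (by positivity)]
        linarith [Nat.cast_nonneg (α := ℝ) m]
      simp [this]
  · rw [lintegral_indicator hKc.measurableSet, lintegral_const]
    exact ENNReal.mul_ne_top ENNReal.ofReal_ne_top (by simpa using hKc.measure_lt_top.ne)
  · filter_upwards [ae_tendsto_mollify hf.locallyIntegrable] with x hx
    have := (hx.sub_const (f x)).enorm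
    simpa using this

/-- Mollifications of an integrable function converge in `L¹`. -/
lemma tendsto_lintegral_mollify_sub {f : Euc n → ℝ} (hf : Integrable f) :
    Tendsto (fun m => ∫⁻ x, ‖mollify m f x - f x‖ₑ) atTop (𝓝 0) := by
  refine ENNReal.tendsto_nhds_zero.2 fun ε hε => ?_
  have hε3 : ε / 3 ≠ 0 := by simpa using hε.ne'
  -- Three-ε argument: mollification contracts L¹, so the error f - h is not amplified.
  obtain ⟨h, hhc, hfh, hcont, hint⟩ := hf.exists_hasCompactSupport_lintegral_sub_le hε3
  have hd : Integrable (f - h) := hf.sub hint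
  filter_upwards [ENNReal.tendsto_nhds_zero.1 (tendsto_lintegral_mollify_sub_of_continuous hcont hhc)
    (ε / 3) (pos_iff_ne_zero.2 hε3)] with m hm
  have hsub := mollify_sub m hf.locallyIntegrable hint.locallyIntegrable
  have e1 : ∀ x, mollify m f x - f x =
      mollify m (f - h) x + (mollify m h x - h x) + (-(f x - h x)) := fun x => by
    rw [hsub, Pi.sub_apply]; ring
  calc ∫⁻ x, ‖mollify m f x - f x‖ₑ
      ≤ ∫⁻ x, (‖mollify m (f - h) x‖ₑ + ‖mollify m h x - h x‖ₑ + ‖f x - h x‖ₑ) := by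
        refine lintegral_mono fun x => ?_
        rw [e1]
        refine (enorm_add_le _ _).trans ?_
        rw [enorm_neg]
        gcongr
        exact enorm_add_le _ _
    _ = (∫⁻ x, ‖mollify m (f - h) x‖ₑ) + (∫⁻ x, ‖mollify m h x - h x‖ₑ) + ∫⁻ x, ‖f x - h x‖ₑ := by
        rw [lintegral_add_right' (g := fun x => ‖f x - h x‖ₑ) _ hd.aestronglyMeasurable.enorm,
          lintegral_add_left]
        exact (contDiff_mollify m hd.locallyIntegrable).continuous.measurable.enorm
    _ ≤ ε / 3 + ε / 3 + ε / 3 := by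
        gcongr
        exact (lintegral_enorm_mollify_le m hd).trans hfh
    _ = ε := ENNReal.add_thirds ε

lemma tendsto_integral_of_enorm_sub_le {us fs : ℕ → Euc n → ℝ} {u f : Euc n → ℝ} {C : ℝ≥0∞}
    (hC : C ≠ ⊤) (hu : Tendsto (fun m => ∫⁻ x, ‖us m x - u x‖ₑ) atTop (𝓝 0))
    (hf : Integrable f) (hfs : ∀ m, Integrable (fs m))
    (h : ∀ m x, ‖fs m x - f x‖ₑ ≤ C * ‖us m x - u x‖ₑ) :
    Tendsto (fun m => ∫ x, fs m x) atTop (𝓝 (∫ x, f x)) := by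
  refine tendsto_integral_of_L1 f hf.aestronglyMeasurable (Eventually.of_forall hfs) ?_
  have h0 : Tendsto (fun m => C * ∫⁻ x, ‖us m x - u x‖ₑ) atTop (𝓝 0) := by
    simpa using ENNReal.Tendsto.const_mul hu (Or.inr hC)
  refine tendsto_of_tendsto_of_tendsto_of_le_of_le tendsto_const_nhds h0
    (fun _ => zero_le) fun m => ?_
  rw [← lintegral_const_mul' _ _ hC]
  exact lintegral_mono (h m)

/-! ### Localization and the chain rule for functions of one real variable -/

namespace HasWeakDeriv

variable {u v g h : Euc n → ℝ}

/-- Weak differentiability is a local property. -/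
lemma of_local (hΩ : IsOpen Ω) (H : ∀ K ⊆ Ω, IsCompact K → ∃ v h, HasWeakDeriv Ω i v h ∧
    EqOn v u K ∧ EqOn h g K) : HasWeakDeriv Ω i u g := by
  refine ⟨locallyIntegrableOn_of_forall_isCompact hΩ fun K hK hKc => ?_,
    locallyIntegrableOn_of_forall_isCompact hΩ fun K hK hKc => ?_, fun η hη => ?_⟩
  · obtain ⟨v, h, hv, e, -⟩ := H K hK hKc
    exact (hv.left.integrableOn_compact_subset hK hKc).congr_fun e hKc.measurableSet
  · obtain ⟨v, h, hv, -, e⟩ := H K hK hKc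
    exact (hv.right.integrableOn_compact_subset hK hKc).congr_fun e hKc.measurableSet
  · obtain ⟨v, h, hv, e, e'⟩ := H _ hη.tsupport_subset hη.hasCompactSupport
    have h1 : ∀ x, u x * partialDeriv i η x = v x * partialDeriv i η x := fun x => by
      by_cases hx : x ∈ tsupport η
      · rw [e hx]
      · rw [image_eq_zero_of_notMem_tsupport
          fun h' => hx (tsupport_partialDeriv_subset (i := i) η h'), mul_zero, mul_zero]
    have h2 : ∀ x, g x * η x = h x * η x := fun x => by
      by_cases hx : x ∈ tsupport η
      · rw [e' hx]
      · rw [image_eq_zero_of_notMem_tsupport hx, mul_zero, mul_zero]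
    simp only [h1, h2]
    exact hv.integral_eq η hη

/-- A weakly differentiable function coincides on a given compact set with an integrable function
on the whole space with an integrable weak derivative. -/
lemma exists_global (hΩ : IsOpen Ω) (H : HasWeakDeriv Ω i u g) {K : Set (Euc n)} (hK : K ⊆ Ω)
    (hKc : IsCompact K) : ∃ v h, HasWeakDeriv univ i v h ∧ Integrable v ∧ Integrable h ∧
      EqOn v u K ∧ EqOn h g K := by
  obtain ⟨χ, hχ, h1⟩ := exists_cutoff hΩ hKc hK
  refine ⟨_, _, H.testFunction_mul hχ, ?_, ?_, fun x hx => ?_, fun x hx => ?_⟩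
  · simpa [mul_comm] using hχ.integrable_mul H.left
  · have := ((hχ.partialDeriv i).integrable_mul H.left).add (hχ.integrable_mul H.right)
    refine this.congr (ae_of_all _ fun x => ?_)
    simp [mul_comm]
  · simp [h1.self_of_nhdsSet x hx]
  · have e : χ =ᶠ[𝓝 x] fun _ => (1 : ℝ) := eventually_nhdsSet_iff_forall.1 h1 x hx
    simp only [partialDeriv_eq_of_eventuallyEq e, e.self_of_nhds]
    simp [partialDeriv]

/-- For the mollifications u_m the identity is classical. Its left side converges because F is
Lipschitz and u_m → u in L¹. On the right, F'(u_m)(g_m - g) tends to 0 in L¹ since F' is bounded,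
and F'(u_m) g → F'(u) g by dominated convergence, since F' is continuous and u_m → u almost
everywhere. -/
lemma comp_global (H : HasWeakDeriv univ i u g) (hu : Integrable u) (hg : Integrable g)
    {F : ℝ → ℝ} (hF : ContDiff ℝ 1 F) {C : ℝ} (hC : ∀ t, |deriv F t| ≤ C) :
    HasWeakDeriv univ i (fun x => F (u x)) (fun x => deriv F (u x) * g x) := by
  have hF' : Continuous (deriv F) := hF.continuous_deriv le_rfl
  have hC0 : 0 ≤ C := (abs_nonneg _).trans (hC 0)
  have lip : ∀ s t, |F s - F t| ≤ C * |s - t| := fun s t => by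
    have := Convex.norm_image_sub_le_of_norm_deriv_le (f := F) (s := univ) (x := t) (y := s)
      (fun x _ => (hF.differentiable one_ne_zero).differentiableAt) (fun x _ => hC x) convex_univ
      (mem_univ _) (mem_univ _)
    simpa using this
  have lipe : ∀ s t, ‖F s - F t‖ₑ ≤ ENNReal.ofReal C * ‖s - t‖ₑ := fun s t => by
    rw [Real.enorm_eq_ofReal_abs, Real.enorm_eq_ofReal_abs, ← ENNReal.ofReal_mul hC0]
    exact ENNReal.ofReal_le_ofReal (lip s t)
  have int1 : LocallyIntegrable (fun x => F (u x)) := by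
    have h1 : LocallyIntegrable (fun x => |F 0| + C * |u x|) :=
      (locallyIntegrable_const _).add (hu.abs.const_mul C).locallyIntegrable
    refine h1.mono (hF.continuous.comp_aestronglyMeasurable hu.aestronglyMeasurable)
      (ae_of_all _ fun x => ?_)
    have h2 := lip (u x) 0
    have h3 := abs_sub_abs_le_abs_sub (F (u x)) (F 0)
    rw [sub_zero] at h2
    rw [Real.norm_eq_abs, Real.norm_eq_abs]
    exact le_trans (by linarith) (le_abs_self _)
  have int2 : Integrable (fun x => deriv F (u x) * g x) :=
    hg.bdd_mul (hF'.comp_aestronglyMeasurable hu.aestronglyMeasurable) (ae_of_all _ fun x => hC _)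
  have L1 := locallyIntegrableOn_univ.2 int1
  have L2 := locallyIntegrableOn_univ.2 int2.locallyIntegrable
  refine ⟨L1, L2, fun η hη => ?_⟩
  obtain ⟨A, hA0, hA⟩ := hη.exists_bound
  obtain ⟨B, hB0, hB⟩ := (hη.partialDeriv i).exists_bound
  have csm : ∀ m, ContDiff ℝ ∞ (mollify m u) := fun m => contDiff_mollify m hu.locallyIntegrable
  have cgm : ∀ m, ContDiff ℝ ∞ (mollify m g) := fun m => contDiff_mollify m hg.locallyIntegrable
  have cF : ∀ m, ContDiff ℝ 1 (fun x => F (mollify m u x)) := fun m =>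
    hF.comp ((csm m).of_le (by simp))
  have hm : ∀ m, ∫ x, F (mollify m u x) * partialDeriv i η x =
      -∫ x, deriv F (mollify m u x) * mollify m g x * η x := fun m => by
    have h1 := (of_contDiffOn (i := i) isOpen_univ (cF m).contDiffOn).integral_eq η hη
    have h2 : ∀ x, partialDeriv i (fun x => F (mollify m u x)) x =
        deriv F (mollify m u x) * mollify m g x := fun x => by
      rw [← partialDeriv_mollify m H]
      have h3 : HasFDerivAt (mollify m u) (fderiv ℝ (mollify m u) x) x :=
        ((csm m).differentiable (by simp) x).hasFDerivAt
      have h4 := (hF.differentiable one_ne_zero (mollify m u x)).hasDerivAt.comp_hasFDerivAt x h3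
      rw [partialDeriv, partialDeriv]
      have h5 : fderiv ℝ (fun x => F (mollify m u x)) x = _ := h4.fderiv
      rw [h5]
      simp
    simpa only [h2] using h1
  have t1 : Tendsto (fun m => ∫ x, F (mollify m u x) * partialDeriv i η x) atTop
      (𝓝 (∫ x, F (u x) * partialDeriv i η x)) := by
    refine tendsto_integral_of_enorm_sub_le (C := ENNReal.ofReal C * ENNReal.ofReal B)
      (by finiteness) (tendsto_lintegral_mollify_sub hu) ((hη.partialDeriv i).integrable_mul L1)
      (fun m => (hη.partialDeriv i).integrable_mul
        (locallyIntegrableOn_univ.2 (cF m).continuous.locallyIntegrable)) fun m x => ?_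
    rw [← sub_mul, enorm_mul, mul_right_comm]
    gcongr
    · exact lipe _ _
    · rw [Real.enorm_eq_ofReal_abs]
      exact ENNReal.ofReal_le_ofReal (hB x)
  have i3 : ∀ m, Integrable (fun x => deriv F (mollify m u x) * g x * η x) := fun m =>
    hη.integrable_mul (locallyIntegrableOn_univ.2 (hg.bdd_mul
      (hF'.comp (csm m).continuous).aestronglyMeasurable
        (ae_of_all _ fun x => hC _)).locallyIntegrable)
  have i4 : ∀ m, Integrable (fun x => deriv F (mollify m u x) * mollify m g x * η x) := fun m =>
    hη.integrable_mul (locallyIntegrableOn_univ.2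
      ((hF'.comp (csm m).continuous).mul (cgm m).continuous).locallyIntegrable)
  have t2 : Tendsto (fun m => ∫ x, deriv F (mollify m u x) * g x * η x) atTop
      (𝓝 (∫ x, deriv F (u x) * g x * η x)) := by
    refine tendsto_integral_of_dominated_convergence (fun x => C * |g x| * A)
      (fun m => (i3 m).aestronglyMeasurable) ((hg.abs.const_mul C).mul_const A)
      (fun m => ae_of_all _ fun x => ?_) ?_
    · rw [norm_mul, norm_mul]
      exact mul_le_mul (mul_le_mul_of_nonneg_right (hC _) (norm_nonneg _)) (hA x)
        (norm_nonneg _) (by positivity)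
    · filter_upwards [ae_tendsto_mollify hu.locallyIntegrable] with x hx
      exact (((hF'.tendsto _).comp hx).mul_const _).mul_const _
  have t3 : Tendsto (fun m => ∫ x, (deriv F (mollify m u x) * mollify m g x * η x -
      deriv F (mollify m u x) * g x * η x)) atTop (𝓝 (∫ _ : Euc n, (0 : ℝ))) := by
    refine tendsto_integral_of_enorm_sub_le (C := ENNReal.ofReal C * ENNReal.ofReal A)
      (by finiteness) (tendsto_lintegral_mollify_sub hg) (integrable_zero _ _ _)
      (fun m => (i4 m).sub (i3 m)) fun m x => ?_
    rw [sub_zero, ← sub_mul, ← mul_sub, enorm_mul, enorm_mul, mul_right_comm]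
    gcongr
    · rw [Real.enorm_eq_ofReal_abs]
      exact ENNReal.ofReal_le_ofReal (hC _)
    · rw [Real.enorm_eq_ofReal_abs]
      exact ENNReal.ofReal_le_ofReal (hA x)
  have t4 := t3.add t2
  rw [integral_zero, zero_add] at t4
  have t5 : Tendsto (fun m => -∫ x, deriv F (mollify m u x) * mollify m g x * η x) atTop
      (𝓝 (-∫ x, deriv F (u x) * g x * η x)) := by
    refine Tendsto.neg (t4.congr fun m => ?_)
    rw [integral_sub (i4 m) (i3 m)]
    ring
  simp only [hm] at t1
  exact tendsto_nhds_unique t1 t5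

/-- The chain rule for a `C¹` function with bounded derivative. -/
lemma comp (hΩ : IsOpen Ω) (H : HasWeakDeriv Ω i u g) {F : ℝ → ℝ} (hF : ContDiff ℝ 1 F) {C : ℝ}
    (hC : ∀ t, |deriv F t| ≤ C) :
    HasWeakDeriv Ω i (fun x => F (u x)) (fun x => deriv F (u x) * g x) := by
  refine of_local hΩ fun K hK hKc => ?_
  obtain ⟨v, h, hv, iv, ih, e, e'⟩ := H.exists_global hΩ hK hKc
  refine ⟨_, _, (hv.comp_global iv ih hF hC).mono (subset_univ _), fun x hx => ?_, fun x hx => ?_⟩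
  · simp only [e hx]
  · simp only [e hx, e' hx]

end HasWeakDeriv

/-! ### Product rule and reciprocals, by truncation -/

/-- A smooth bounded approximation of the identity of `ℝ`. -/
noncomputable def trunc (ε t : ℝ) : ℝ := t / (1 + ε * t ^ 2)

section trunc

variable {ε : ℝ}

lemma one_add_mul_sq_pos (hε : 0 < ε) (t : ℝ) : 0 < 1 + ε * t ^ 2 := by positivity

lemma contDiff_trunc (hε : 0 < ε) : ContDiff ℝ 1 (trunc ε) := by
  unfold trunc
  exact contDiff_id.div (by fun_prop) fun t => (one_add_mul_sq_pos hε t).ne'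

lemma deriv_trunc (hε : 0 < ε) (t : ℝ) :
    deriv (trunc ε) t = (1 - ε * t ^ 2) / (1 + ε * t ^ 2) ^ 2 := by
  have h1 : HasDerivAt (fun t : ℝ => 1 + ε * t ^ 2) (ε * (2 * t)) t := by
    simpa using ((hasDerivAt_pow 2 t).const_mul ε).const_add 1
  have h := ((hasDerivAt_id t).div h1 (one_add_mul_sq_pos hε t).ne').deriv
  have e : trunc ε = id / fun t : ℝ => 1 + ε * t ^ 2 := rfl
  rw [e, h]
  simp only [id]
  ring

lemma abs_trunc_le (hε : 0 < ε) (t : ℝ) : |trunc ε t| ≤ |t| := by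
  rw [trunc, abs_div, abs_of_pos (one_add_mul_sq_pos hε t)]
  exact div_le_self (abs_nonneg _) (by nlinarith [sq_nonneg t])

lemma abs_trunc_le_inv (hε : 0 < ε) (hε1 : ε ≤ 1) (t : ℝ) : |trunc ε t| ≤ 1 / ε := by
  rw [trunc, abs_div, abs_of_pos (one_add_mul_sq_pos hε t),
    div_le_div_iff₀ (one_add_mul_sq_pos hε t) hε, ← sq_abs t]
  nlinarith [sq_nonneg (|t| - 1), abs_nonneg t]

/-- The bound does not depend on ε; together with `abs_trunc_le` it provides the dominating
functions when ε → 0. -/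
lemma abs_deriv_trunc_le (hε : 0 < ε) (t : ℝ) : |deriv (trunc ε) t| ≤ 1 := by
  have h := one_add_mul_sq_pos hε t
  have h2 : 0 ≤ ε * t ^ 2 := by positivity
  rw [deriv_trunc hε, abs_div, abs_of_pos (by positivity : (0 : ℝ) < (1 + ε * t ^ 2) ^ 2),
    div_le_one (by positivity), abs_le]
  constructor <;> nlinarith

lemma tendsto_trunc (t : ℝ) :
    Tendsto (fun m : ℕ => trunc (1 / ((m : ℝ) + 1)) t) atTop (𝓝 t) := by
  have h := (((tendsto_one_div_add_atTop_nhds_zero_nat (𝕜 := ℝ)).mul_const (t ^ 2)).const_add 1)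
  convert! (tendsto_const_nhds (x := t)).div h (by simp) using 2
  simp

lemma tendsto_deriv_trunc (t : ℝ) :
    Tendsto (fun m : ℕ => deriv (trunc (1 / ((m : ℝ) + 1))) t) atTop (𝓝 1) := by
  have h0 := (tendsto_one_div_add_atTop_nhds_zero_nat (𝕜 := ℝ)).mul_const (t ^ 2)
  have := (h0.const_sub 1).div ((h0.const_add 1).pow 2) (by simp)
  simp only [deriv_trunc Nat.one_div_pos_of_nat]
  convert! this using 2
  simp

end trunc

lemma locallyIntegrableOn_bdd_mul (hΩ : IsOpen Ω) {f g : Euc n → ℝ} (hf : LocallyIntegrableOn f Ω)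
    {C : ℝ} (hC : ∀ x, |f x| ≤ C) (hg : LocallyIntegrableOn g Ω) :
    LocallyIntegrableOn (fun x => f x * g x) Ω :=
  locallyIntegrableOn_of_forall_isCompact hΩ fun _ hK hKc =>
    (hg.integrableOn_compact_subset hK hKc).bdd_mul
      (hf.integrableOn_compact_subset hK hKc).aestronglyMeasurable (ae_of_all _ hC)

namespace HasWeakDeriv

variable {u v g h : Euc n → ℝ}

lemma congr_eq {u' g' : Euc n → ℝ} (H : HasWeakDeriv Ω i u g) (hu : ∀ x, u x = u' x)
    (hg : ∀ x, g x = g' x) : HasWeakDeriv Ω i u' g' := by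
  obtain rfl : u = u' := funext hu
  obtain rfl : g = g' := funext hg
  exact H

/-- The derivative of t² is unbounded, so the chain rule is applied to the square of `trunc ε`, and
then ε → 0. Boundedness of u makes the dominating functions u² and 2|u g| locally integrable. -/
lemma sq_of_bounded (hΩ : IsOpen Ω) (H : HasWeakDeriv Ω i u g) {C : ℝ} (hC : ∀ x, |u x| ≤ C) :
    HasWeakDeriv Ω i (fun x => u x * u x) (fun x => 2 * (u x * g x)) := by
  have hε : ∀ m : ℕ, (0 : ℝ) < 1 / ((m : ℝ) + 1) := fun m => Nat.one_div_pos_of_nat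
  have hd : ∀ m : ℕ, ∀ t, deriv (fun t => trunc (1 / ((m : ℝ) + 1)) t ^ 2) t =
      2 * trunc (1 / ((m : ℝ) + 1)) t * deriv (trunc (1 / ((m : ℝ) + 1))) t := fun m t => by
    have := (((contDiff_trunc (hε m)).differentiable one_ne_zero) t).hasDerivAt.pow 2
    have h2 := this.deriv
    simpa [Pi.pow_def] using h2
  have hb : ∀ (m : ℕ) (a t : ℝ), |trunc (1 / ((m : ℝ) + 1)) t| ≤ a →
      |2 * trunc (1 / ((m : ℝ) + 1)) t * deriv (trunc (1 / ((m : ℝ) + 1))) t| ≤ 2 * a := by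
    intro m a t ha
    rw [abs_mul, abs_mul, abs_two]
    have := abs_deriv_trunc_le (hε m) t
    nlinarith [abs_nonneg (trunc (1 / ((m : ℝ) + 1)) t),
      abs_nonneg (deriv (trunc (1 / ((m : ℝ) + 1))) t)]
  refine of_tendsto hΩ (us := fun m x => trunc (1 / ((m : ℝ) + 1)) (u x) ^ 2)
    (gs := fun m x => 2 * trunc (1 / ((m : ℝ) + 1)) (u x) *
      deriv (trunc (1 / ((m : ℝ) + 1))) (u x) * g x)
    (U := fun x => u x * u x) (G := fun x => 2 * |u x * g x|)
    (fun m => ?_) (locallyIntegrableOn_bdd_mul hΩ H.left hC H.left)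
    ((locallyIntegrableOn_bdd_mul hΩ H.left hC H.right).norm.smul (2 : ℝ))
    (fun m => ae_of_all _ fun x => ?_) (fun m => ae_of_all _ fun x => ?_)
    (ae_of_all _ fun x => ?_) (ae_of_all _ fun x => ?_)
  · have := H.comp hΩ ((contDiff_trunc (hε m)).pow 2) (C := 2 * (1 / (1 / ((m : ℝ) + 1))))
      fun t => by
        rw [hd]
        refine hb m _ t (abs_trunc_le_inv (hε m) ?_ t)
        rw [div_le_one (by positivity)]
        linarith [Nat.cast_nonneg (α := ℝ) m]
    simpa only [hd] using this
  · rw [abs_of_nonneg (sq_nonneg _), ← sq, ← sq_abs, ← sq_abs (u x)]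
    have := abs_trunc_le (hε m) (u x)
    gcongr
  · rw [abs_mul, abs_mul (u x), ← mul_assoc]
    exact mul_le_mul_of_nonneg_right (hb m _ _ (abs_trunc_le (hε m) (u x))) (abs_nonneg _)
  · simpa [sq] using (tendsto_trunc (u x)).pow 2
  · have := (((tendsto_trunc (u x)).const_mul 2).mul (tendsto_deriv_trunc (u x))).mul_const (g x)
    convert! this using 2
    ring

/-- Polarization: uv = ((u + v)² - u² - v²) / 2. -/
lemma mul_of_bounded (hΩ : IsOpen Ω) (H : HasWeakDeriv Ω i u g) (H' : HasWeakDeriv Ω i v h)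
    {C D : ℝ} (hC : ∀ x, |u x| ≤ C) (hD : ∀ x, |v x| ≤ D) :
    HasWeakDeriv Ω i (fun x => u x * v x) (fun x => g x * v x + u x * h x) := by
  have h1 := (H.add H').sq_of_bounded hΩ (C := C + D)
    fun x => (abs_add_le _ _).trans (add_le_add (hC x) (hD x))
  have h2 := ((h1.const_mul (1 / 2)).add ((H.sq_of_bounded hΩ hC).const_mul (-(1 / 2)))).add
    ((H'.sq_of_bounded hΩ hD).const_mul (-(1 / 2)))
  exact h2.congr_eq (fun x => by ring) (fun x => by ring)

/-- The product rule, under the weakest integrability conditions. -/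
lemma mul (hΩ : IsOpen Ω) (H : HasWeakDeriv Ω i u g) (H' : HasWeakDeriv Ω i v h)
    (h1 : LocallyIntegrableOn (fun x => u x * v x) Ω)
    (h2 : LocallyIntegrableOn (fun x => g x * v x) Ω)
    (h3 : LocallyIntegrableOn (fun x => u x * h x) Ω) :
    HasWeakDeriv Ω i (fun x => u x * v x) (fun x => g x * v x + u x * h x) := by
  have hε : ∀ m : ℕ, (0 : ℝ) < 1 / ((m : ℝ) + 1) := fun m => Nat.one_div_pos_of_nat
  have hε1 : ∀ m : ℕ, 1 / ((m : ℝ) + 1) ≤ 1 := fun m => by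
    rw [div_le_one (by positivity)]
    linarith [Nat.cast_nonneg (α := ℝ) m]
  -- The truncations of u and v fall under the bounded case. They are dominated by |u| and |v|, and
  -- their derivatives by |g| and |h|, so the three assumed products dominate everything in the
  -- limit.
  have A : ∀ {u g : Euc n → ℝ}, HasWeakDeriv Ω i u g → ∀ m : ℕ, HasWeakDeriv Ω i
      (fun x => trunc (1 / ((m : ℝ) + 1)) (u x))
      (fun x => deriv (trunc (1 / ((m : ℝ) + 1))) (u x) * g x) := fun H m =>
    H.comp hΩ (contDiff_trunc (hε m)) (abs_deriv_trunc_le (hε m))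
  refine of_tendsto hΩ
    (U := fun x => |u x * v x|) (G := fun x => |g x * v x| + |u x * h x|)
    (fun m => (A H m).mul_of_bounded hΩ (A H' m) (fun x => abs_trunc_le_inv (hε m) (hε1 m) _)
      (fun x => abs_trunc_le_inv (hε m) (hε1 m) _)) h1.norm (h2.norm.add h3.norm)
    (fun m => ae_of_all _ fun x => ?_) (fun m => ae_of_all _ fun x => ?_)
    (ae_of_all _ fun x => (tendsto_trunc _).mul (tendsto_trunc _))
    (ae_of_all _ fun x => ?_)
  · rw [abs_mul, abs_mul]
    exact mul_le_mul (abs_trunc_le (hε m) _) (abs_trunc_le (hε m) _) (abs_nonneg _) (abs_nonneg _)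
  · refine (abs_add_le _ _).trans (add_le_add ?_ ?_)
    · rw [abs_mul, abs_mul, abs_mul]
      refine mul_le_mul ?_ (abs_trunc_le (hε m) _) (abs_nonneg _) (abs_nonneg _)
      exact mul_le_of_le_one_left (abs_nonneg _) (abs_deriv_trunc_le (hε m) _)
    · rw [abs_mul, abs_mul, abs_mul]
      refine mul_le_mul (abs_trunc_le (hε m) _) ?_ (by positivity) (abs_nonneg _)
      exact mul_le_of_le_one_left (abs_nonneg _) (abs_deriv_trunc_le (hε m) _)
  · have := (((tendsto_deriv_trunc (u x)).mul_const (g x)).mul (tendsto_trunc (v x))).add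
      ((tendsto_trunc (u x)).mul ((tendsto_deriv_trunc (v x)).mul_const (h x)))
    simpa using this

/-- The weak derivative of the reciprocal of a function that is locally bounded away from `0`. -/
lemma inv (hΩ : IsOpen Ω) (H : HasWeakDeriv Ω i u g)
    (hu : ∀ K ⊆ Ω, IsCompact K → ∃ c, 0 < c ∧ ∀ x ∈ K, c ≤ |u x|) :
    HasWeakDeriv Ω i (fun x => (u x)⁻¹) (fun x => -((u x)⁻¹ * (u x)⁻¹ * g x)) := by
  have h0 : ∀ x ∈ Ω, u x ≠ 0 := fun x hx => by
    obtain ⟨c, hc, hcx⟩ := hu {x} (by simpa using hx) isCompact_singleton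
    exact abs_pos.1 (hc.trans_le (hcx x rfl))
  have hε : ∀ m : ℕ, (0 : ℝ) < 1 / ((m : ℝ) + 1) := fun m => Nat.one_div_pos_of_nat
  have pos : ∀ (m : ℕ) (t : ℝ), 0 < t ^ 2 + 1 / ((m : ℝ) + 1) := fun m t => by positivity
  -- These regularizations of 1/t are C¹ on all of ℝ with bounded derivative. For t ≠ 0 they satisfy
  -- |F| ≤ 1/|t| and |F'| ≤ 1/t², uniformly in m.
  set F : ℕ → ℝ → ℝ := fun m t => t / (t ^ 2 + 1 / ((m : ℝ) + 1)) with hF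
  have hd : ∀ m t, deriv (F m) t =
      (1 / ((m : ℝ) + 1) - t ^ 2) / (t ^ 2 + 1 / ((m : ℝ) + 1)) ^ 2 := fun m t => by
    have h1 : HasDerivAt (fun t : ℝ => t ^ 2 + 1 / ((m : ℝ) + 1)) (2 * t) t := by
      simpa using (hasDerivAt_pow 2 t).add_const (1 / ((m : ℝ) + 1))
    have h := ((hasDerivAt_id t).div h1 (pos m t).ne').deriv
    have e : F m = id / fun t : ℝ => t ^ 2 + 1 / ((m : ℝ) + 1) := rfl
    rw [e, h]
    simp only [id]
    ring
  have hdb : ∀ m t, |deriv (F m) t| ≤ 1 / (t ^ 2 + 1 / ((m : ℝ) + 1)) := fun m t => by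
    have hp := pos m t
    have ht := sq_nonneg t
    have he := (hε m).le
    rw [hd, abs_div, abs_of_pos (pow_pos hp 2), div_le_div_iff₀ (pow_pos hp 2) hp, one_mul, sq,
      ← sq]
    have : |1 / ((m : ℝ) + 1) - t ^ 2| ≤ t ^ 2 + 1 / ((m : ℝ) + 1) := by
      rw [abs_le]; constructor <;> linarith
    calc _ ≤ (t ^ 2 + 1 / ((m : ℝ) + 1)) * (t ^ 2 + 1 / ((m : ℝ) + 1)) := by gcongr
      _ = _ := by ring
  have bdd : ∀ K ⊆ Ω, IsCompact K → ∃ C, ∀ᵐ x ∂volume.restrict K, ‖(u x)⁻¹‖ ≤ C := by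
    intro K hK hKc
    obtain ⟨c, hc, hcx⟩ := hu K hK hKc
    refine ⟨c⁻¹, (ae_restrict_iff' hKc.measurableSet).2 (ae_of_all _ fun x hx => ?_)⟩
    rw [norm_inv]
    exact inv_anti₀ hc (hcx x hx)
  have meas : ∀ K ⊆ Ω, IsCompact K →
      AEStronglyMeasurable (fun x => (u x)⁻¹) (volume.restrict K) := fun K hK hKc =>
    (H.left.integrableOn_compact_subset hK hKc).aestronglyMeasurable.aemeasurable.inv
      |>.aestronglyMeasurable
  have L1 : LocallyIntegrableOn (fun x => (u x)⁻¹) Ω :=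
    locallyIntegrableOn_of_forall_isCompact hΩ fun K hK hKc => by
      obtain ⟨C, hC⟩ := bdd K hK hKc
      have : IsFiniteMeasure (volume.restrict K) := ⟨by simpa using hKc.measure_lt_top⟩
      exact Integrable.of_bound (meas K hK hKc) C hC
  have L2 : LocallyIntegrableOn (fun x => (u x)⁻¹ * ((u x)⁻¹ * g x)) Ω :=
    locallyIntegrableOn_of_forall_isCompact hΩ fun K hK hKc => by
      obtain ⟨C, hC⟩ := bdd K hK hKc
      exact ((H.right.integrableOn_compact_subset hK hKc).bdd_mul (meas K hK hKc) hC).bdd_mul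
        (meas K hK hKc) hC
  have inΩ : ∀ᵐ x ∂volume.restrict Ω, x ∈ Ω := ae_restrict_mem hΩ.measurableSet
  refine of_tendsto hΩ (U := fun x => |(u x)⁻¹|) (G := fun x => |(u x)⁻¹ * ((u x)⁻¹ * g x)|)
    (fun m => H.comp hΩ (F := F m) (C := 1 / (1 / ((m : ℝ) + 1))) ?_ fun t => ?_) L1.norm L2.norm
    (fun m => ?_) (fun m => ?_) ?_ ?_
  · exact contDiff_id.div (by fun_prop) fun t => (pos m t).ne'
  · refine (hdb m t).trans ?_
    exact one_div_le_one_div_of_le (hε m) (le_add_of_nonneg_left (sq_nonneg t))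
  · filter_upwards [inΩ] with x hx
    have h := abs_pos.2 (h0 x hx)
    rw [abs_inv, hF, abs_div, abs_of_pos (pos m _), ← one_div, div_le_div_iff₀ (pos m _) h,
      ← sq_abs]
    nlinarith [hε m]
  · filter_upwards [inΩ] with x hx
    have h := abs_pos.2 (h0 x hx)
    rw [← mul_assoc, abs_mul, abs_mul _ (g x)]
    refine mul_le_mul_of_nonneg_right ((hdb m _).trans ?_) (abs_nonneg _)
    rw [abs_mul, abs_inv, ← mul_inv, abs_mul_abs_self, ← one_div, ← sq]
    exact one_div_le_one_div_of_le (by rw [← sq_abs]; positivity)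
      (le_add_of_nonneg_right (hε m).le)
  · filter_upwards [inΩ] with x hx
    have h := (tendsto_const_nhds (x := u x)).div
      ((tendsto_one_div_add_atTop_nhds_zero_nat (𝕜 := ℝ)).const_add (u x ^ 2))
      (by simpa using h0 x hx)
    convert! h using 2
    have := h0 x hx
    field_simp
    simp
  · filter_upwards [inΩ] with x hx
    have h0' := tendsto_one_div_add_atTop_nhds_zero_nat (𝕜 := ℝ)
    have h := ((h0'.sub_const (u x ^ 2)).div ((h0'.const_add (u x ^ 2)).pow 2)
      (by simpa using h0 x hx)).mul_const (g x)
    simp only [hd]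
    convert! h using 2
    have := h0 x hx
    field_simp
    simp only [add_zero, zero_sub]
    ring

end HasWeakDeriv

/-! ### Local Lebesgue spaces and composition with a diffeomorphism -/

/-- `f ∈ L^p_loc(Ω)`. -/
def MemLpLoc (p : ℝ≥0∞) (Ω : Set (Euc n)) (f : Euc n → ℝ) : Prop :=
  ∀ K ⊆ Ω, IsCompact K → MemLp f p (volume.restrict K)

lemma MemLpLoc.locallyIntegrableOn {p : ℝ≥0∞} {f : Euc n → ℝ} (h : MemLpLoc p Ω f)
    (hp : 1 ≤ p) (hΩ : IsOpen Ω) : LocallyIntegrableOn f Ω :=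
  locallyIntegrableOn_of_forall_isCompact hΩ fun K hK hKc => by
    have : IsFiniteMeasure (volume.restrict K) := ⟨by simpa using hKc.measure_lt_top⟩
    exact (h K hK hKc).integrable hp

lemma MemLpLoc.of_locallyIntegrableOn {f : Euc n → ℝ} (h : LocallyIntegrableOn f Ω) :
    MemLpLoc 1 Ω f := fun _ hK hKc =>
  memLp_one_iff_integrable.2 (h.integrableOn_compact_subset hK hKc)

section diffeo

variable {φ : OpenPartialHomeomorph (Euc n) (Euc n)}

lemma _root_.IsC1Diffeomorphism.isOpen_left (d : IsC1Diffeomorphism φ Ω Ω') : IsOpen Ω := d.source_eq ▸ φ.open_source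

lemma _root_.IsC1Diffeomorphism.isOpen_right (d : IsC1Diffeomorphism φ Ω Ω') : IsOpen Ω' := d.target_eq ▸ φ.open_target

lemma _root_.IsC1Diffeomorphism.mapsTo_symm (d : IsC1Diffeomorphism φ Ω Ω') : MapsTo φ.symm Ω' Ω := by
  rw [← d.source_eq, ← d.target_eq]
  exact φ.mapsTo_symm

lemma _root_.IsC1Diffeomorphism.right_inv (d : IsC1Diffeomorphism φ Ω Ω') {y : Euc n} (hy : y ∈ Ω') : φ (φ.symm y) = y :=
  φ.right_inv (d.target_eq ▸ hy)

lemma _root_.IsC1Diffeomorphism.isCompact_image (d : IsC1Diffeomorphism φ Ω Ω') {K : Set (Euc n)} (hK : K ⊆ Ω') (hKc : IsCompact K) :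
    IsCompact (φ.symm '' K) :=
  hKc.image_of_continuousOn (d.contDiffOn_symm.continuousOn.mono hK)

lemma _root_.IsC1Diffeomorphism.image_subset (d : IsC1Diffeomorphism φ Ω Ω') {K : Set (Euc n)} (hK : K ⊆ Ω') : φ.symm '' K ⊆ Ω :=
  (image_mono hK).trans (d.mapsTo_symm.image_subset)

lemma _root_.IsC1Diffeomorphism.aemeasurable_symm (d : IsC1Diffeomorphism φ Ω Ω') {K : Set (Euc n)} (hK : K ⊆ Ω') (hKc : IsCompact K) :
    AEMeasurable φ.symm (volume.restrict K) :=
  (d.contDiffOn_symm.continuousOn.mono hK).aemeasurable hKc.measurableSet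

/-- The inverse diffeomorphism distorts volumes by a locally bounded factor. -/
lemma _root_.IsC1Diffeomorphism.exists_map_le (d : IsC1Diffeomorphism φ Ω Ω') {K : Set (Euc n)} (hK : K ⊆ Ω') (hKc : IsCompact K) :
    ∃ C : ℝ≥0∞, C ≠ ⊤ ∧
      Measure.map φ.symm (volume.restrict K) ≤ C • volume.restrict (φ.symm '' K) := by
  set s := φ.symm '' K with hs
  have hsc : IsCompact s := d.isCompact_image hK hKc
  have hsΩ : s ⊆ Ω := d.image_subset hK
  have himg : φ '' s = K := by
    rw [hs, image_image]
    exact (image_congr fun y hy => d.right_inv (hK hy)).trans (image_id K)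
  have hinj : InjOn φ s := φ.injOn.mono (d.source_eq ▸ hsΩ)
  have hder : ∀ x ∈ s, HasFDerivWithinAt φ (fderiv ℝ φ x) s x := fun x hx =>
    ((d.contDiffOn.differentiableOn one_ne_zero).differentiableAt
      (d.isOpen_left.mem_nhds (hsΩ hx))).hasFDerivAt.hasFDerivWithinAt
  -- Change of variables: φ pushes |det Dφ| dx on s forward to Lebesgue measure on K. Pushing back
  -- by the inverse leaves the measure |det Dφ| dx, whose density is bounded on the compact set s.
  have hmap := map_withDensity_abs_det_fderiv_eq_addHaar volume hsc.measurableSet.nullMeasurableSet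
    hder hinj
  rw [himg] at hmap
  have hcont : ContinuousOn (fun x => (fderiv ℝ φ x).det) s :=
    ContinuousLinearMap.continuous_det.comp_continuousOn
      ((d.contDiffOn.continuousOn_fderiv_of_isOpen d.isOpen_left le_rfl).mono hsΩ)
  obtain ⟨C, hC⟩ := hsc.exists_bound_of_continuousOn hcont
  set ν := (volume.restrict s).withDensity fun x => ENNReal.ofReal |(fderiv ℝ φ x).det| with hν
  have hνs : ∀ᵐ x ∂ν, x ∈ s :=
    (withDensity_absolutelyContinuous _ _).ae_le (ae_restrict_mem hsc.measurableSet)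
  have hφm : AEMeasurable φ ν :=
    ((d.contDiffOn.continuousOn.mono hsΩ).aemeasurable hsc.measurableSet).mono_ac
      (withDensity_absolutelyContinuous _ _)
  have hψm : AEMeasurable φ.symm (Measure.map φ ν) := by
    rw [hmap]
    exact d.aemeasurable_symm hK hKc
  refine ⟨ENNReal.ofReal C, ENNReal.ofReal_ne_top, ?_⟩
  rw [← hmap, AEMeasurable.map_map_of_aemeasurable hψm hφm]
  have hid : φ.symm ∘ φ =ᵐ[ν] id := by
    filter_upwards [hνs] with x hx
    exact φ.left_inv (d.source_eq ▸ hsΩ hx)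
  rw [Measure.map_congr hid, Measure.map_id, hν, ← withDensity_const]
  refine withDensity_mono ((ae_restrict_iff' hsc.measurableSet).2 (ae_of_all _ fun x hx => ?_))
  exact ENNReal.ofReal_le_ofReal (hC x hx)

lemma _root_.IsC1Diffeomorphism.memLpLoc_comp (d : IsC1Diffeomorphism φ Ω Ω') {f : Euc n → ℝ} {p : ℝ≥0∞} (hf : MemLpLoc p Ω f) :
    MemLpLoc p Ω' (fun y => f (φ.symm y)) := fun K hK hKc => by
  obtain ⟨C, hC, hle⟩ := d.exists_map_le hK hKc
  have h1 : MemLp f p (Measure.map φ.symm (volume.restrict K)) :=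
    (hf _ (d.image_subset hK) (d.isCompact_image hK hKc)).of_measure_le_smul hC hle
  exact (memLp_map_measure_iff h1.1 (d.aemeasurable_symm hK hKc)).1 h1

/-- By `exists_map_le`, L¹ convergence survives composition with the inverse on a compact set, and
the continuous weight ρ is bounded there. -/
lemma _root_.IsC1Diffeomorphism.tendsto_setIntegral_comp (d : IsC1Diffeomorphism φ Ω Ω') {K : Set (Euc n)} (hK : K ⊆ Ω') (hKc : IsCompact K)
    {us : ℕ → Euc n → ℝ} {u ρ : Euc n → ℝ} (hus : ∀ m, Continuous (us m)) (hu : Integrable u)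
    (h : Tendsto (fun m => ∫⁻ x, ‖us m x - u x‖ₑ) atTop (𝓝 0)) (hρ : ContinuousOn ρ K) :
    Tendsto (fun m => ∫ y in K, us m (φ.symm y) * ρ y) atTop
      (𝓝 (∫ y in K, u (φ.symm y) * ρ y)) := by
  obtain ⟨C, hC, hle⟩ := d.exists_map_le hK hKc
  obtain ⟨A, hA⟩ := hKc.exists_bound_of_continuousOn hρ
  have hint : ∀ {v : Euc n → ℝ}, LocallyIntegrable v →
      IntegrableOn (fun y => v (φ.symm y) * ρ y) K := fun hv =>
    IntegrableOn.mul_continuousOn (memLp_one_iff_integrable.1 (d.memLpLoc_comp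
      (MemLpLoc.of_locallyIntegrableOn (hv.locallyIntegrableOn Ω)) K hK hKc)) hρ hKc
  refine tendsto_integral_of_L1 _ (hint hu.locallyIntegrable).aestronglyMeasurable
    (Eventually.of_forall fun m => hint (hus m).locallyIntegrable) ?_
  have h0 : Tendsto (fun m => ENNReal.ofReal A * (C * ∫⁻ x, ‖us m x - u x‖ₑ)) atTop (𝓝 0) := by
    have h1 := ENNReal.Tendsto.const_mul h (Or.inr hC)
    simpa using ENNReal.Tendsto.const_mul h1 (Or.inr (ENNReal.ofReal_ne_top (r := A)))
  refine tendsto_of_tendsto_of_tendsto_of_le_of_le tendsto_const_nhds h0 (fun _ => zero_le)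
    fun m => ?_
  have meas : AEMeasurable (fun x => ‖us m x - u x‖ₑ)
      (Measure.map φ.symm (volume.restrict K)) := by
    have h1 : AEMeasurable (fun x => ‖us m x - u x‖ₑ) (C • volume.restrict (φ.symm '' K)) :=
      (((hus m).aestronglyMeasurable.sub hu.aestronglyMeasurable).enorm.restrict).smul_measure C
    exact h1.mono_measure hle
  calc ∫⁻ y in K, ‖us m (φ.symm y) * ρ y - u (φ.symm y) * ρ y‖ₑ
      ≤ ∫⁻ y in K, ENNReal.ofReal A * ‖us m (φ.symm y) - u (φ.symm y)‖ₑ := by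
        refine lintegral_mono_ae ((ae_restrict_iff' hKc.measurableSet).2 (ae_of_all _ fun y hy => ?_))
        rw [← sub_mul, enorm_mul, mul_comm]
        gcongr
        rw [Real.enorm_eq_ofReal_abs]
        exact ENNReal.ofReal_le_ofReal (hA y hy)
    _ = ENNReal.ofReal A * ∫⁻ x, ‖us m x - u x‖ₑ ∂Measure.map φ.symm (volume.restrict K) := by
        rw [lintegral_const_mul' _ _ ENNReal.ofReal_ne_top,
          lintegral_map' meas (d.aemeasurable_symm hK hKc)]
    _ ≤ ENNReal.ofReal A * (C * ∫⁻ x, ‖us m x - u x‖ₑ) := by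
        gcongr
        refine (lintegral_mono' hle le_rfl).trans ?_
        rw [lintegral_smul_measure, smul_eq_mul]
        gcongr
        exact Measure.restrict_le_self

lemma fderiv_apply_eq_sum (v : Euc n → ℝ) (x w : Euc n) :
    fderiv ℝ v x w = ∑ j, partialDeriv j v x * w j := by
  have hw : w = ∑ j, w j • EuclideanSpace.single j (1 : ℝ) := by
    simpa using ((EuclideanSpace.basisFun (Fin n) ℝ).sum_repr w).symm
  conv_lhs => rw [hw]
  simp [partialDeriv, mul_comm]

lemma partialDeriv_comp {v : Euc n → ℝ} {ψ : Euc n → Euc n} {y : Euc n}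
    (hv : DifferentiableAt ℝ v (ψ y)) (hψ : DifferentiableAt ℝ ψ y) :
    partialDeriv i (fun y => v (ψ y)) y =
      ∑ j, partialDeriv j v (ψ y) * partialDeriv i (fun y => ψ y j) y := by
  have h1 : fderiv ℝ (fun y => v (ψ y)) y = (fderiv ℝ v (ψ y)).comp (fderiv ℝ ψ y) :=
    fderiv_fun_comp y hv hψ
  rw [partialDeriv, h1, ContinuousLinearMap.comp_apply, fderiv_apply_eq_sum]
  refine Finset.sum_congr rfl fun j _ => ?_
  have h2 : HasFDerivAt (fun y => ψ y j)
      ((EuclideanSpace.proj j : Euc n →L[ℝ] ℝ).comp (fderiv ℝ ψ y)) y :=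
    (EuclideanSpace.proj j : Euc n →L[ℝ] ℝ).hasFDerivAt.comp y hψ.hasFDerivAt
  rw [partialDeriv, partialDeriv, h2.fderiv]
  rfl

lemma contDiffOn_coord {ψ : Euc n → Euc n} (h : ContDiffOn ℝ 1 ψ Ω) (j : Fin n) :
    ContDiffOn ℝ 1 (fun y => ψ y j) Ω :=
  (EuclideanSpace.proj j : Euc n →L[ℝ] ℝ).contDiff.comp_contDiffOn h

lemma continuousOn_partialDeriv {u : Euc n → ℝ} (hΩ : IsOpen Ω) (hu : ContDiffOn ℝ 1 u Ω) :
    ContinuousOn (partialDeriv i u) Ω :=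
  (hu.continuousOn_fderiv_of_isOpen hΩ le_rfl).clm_apply continuousOn_const

/-- The weak chain rule for the composition with a `C¹`-diffeomorphism. -/
lemma HasWeakDeriv.comp_symm (d : IsC1Diffeomorphism φ Ω Ω') {f : Euc n → ℝ}
    {f' : Fin n → Euc n → ℝ} (H : ∀ j, HasWeakDeriv Ω j f (f' j)) (i : Fin n) :
    HasWeakDeriv Ω' i (fun y => f (φ.symm y))
      (fun y => ∑ j, f' j (φ.symm y) * partialDeriv i (fun y => φ.symm y j) y) := by
  have hΩ := d.isOpen_left
  have hΩ' := d.isOpen_right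
  have hψ' : ∀ j, ContinuousOn (partialDeriv i fun y => φ.symm y j) Ω' := fun j =>
    continuousOn_partialDeriv hΩ' (contDiffOn_coord d.contDiffOn_symm j)
  have tr : ∀ {g : Euc n → ℝ}, LocallyIntegrableOn g Ω →
      LocallyIntegrableOn (fun y => g (φ.symm y)) Ω' := fun hg =>
    (d.memLpLoc_comp (MemLpLoc.of_locallyIntegrableOn hg)).locallyIntegrableOn le_rfl hΩ'
  have L1 : LocallyIntegrableOn (fun y => f (φ.symm y)) Ω' := tr (H i).left
  have L2 : ∀ j, LocallyIntegrableOn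
      (fun y => f' j (φ.symm y) * partialDeriv i (fun y => φ.symm y j) y) Ω' := fun j =>
    locallyIntegrableOn_of_forall_isCompact hΩ' fun K hK hKc =>
      ((tr (H j).right).integrableOn_compact_subset hK hKc).mul_continuousOn ((hψ' j).mono hK) hKc
  refine ⟨L1, ?_, fun η hη => ?_⟩
  · exact locallyIntegrableOn_of_forall_isCompact hΩ' fun K hK hKc =>
      integrable_finsetSum _ fun j _ => (L2 j).integrableOn_compact_subset hK hKc
  set K := tsupport η with hKdef
  have hK : K ⊆ Ω' := hη.tsupport_subset
  have hKc : IsCompact K := hη.hasCompactSupport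
  have out : ∀ x ∉ K, η x = 0 := fun x hx => image_eq_zero_of_notMem_tsupport hx
  have out' : ∀ x ∉ K, partialDeriv i η x = 0 := fun x hx =>
    image_eq_zero_of_notMem_tsupport fun h => hx (tsupport_partialDeriv_subset η h)
  have hset : ∀ {g ζ : Euc n → ℝ}, (∀ x ∉ K, ζ x = 0) →
      ∫ x, g x * ζ x = ∫ x in K, g x * ζ x := fun h =>
    (setIntegral_eq_integral_of_forall_compl_eq_zero fun x hx => by rw [h x hx, mul_zero]).symm
  -- The cut-off turns f into an integrable function on the whole space, which can be mollified,
  -- without changing f or its weak derivatives on the preimage of the support of η.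
  obtain ⟨χ, hχ, hχ1⟩ := exists_cutoff hΩ (d.isCompact_image hK hKc)
    (d.image_subset hK)
  set v : Euc n → ℝ := fun x => χ x * f x
  set w : Fin n → Euc n → ℝ := fun j x => partialDeriv j χ x * f x + χ x * f' j x
  have hvw : ∀ j, HasWeakDeriv univ j v (w j) := fun j => (H j).testFunction_mul hχ
  have iv : Integrable v := by simpa [v, mul_comm] using hχ.integrable_mul (H i).left
  have iw : ∀ j, Integrable (w j) := fun j => by
    refine (((hχ.partialDeriv j).integrable_mul (H j).left).add
      (hχ.integrable_mul (H j).right)).congr (ae_of_all _ fun x => ?_)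
    simp [w, mul_comm]
  have ev : ∀ y ∈ K, v (φ.symm y) = f (φ.symm y) := fun y hy => by
    simp [v, hχ1.self_of_nhdsSet _ (mem_image_of_mem _ hy)]
  have ew : ∀ j, ∀ y ∈ K, w j (φ.symm y) = f' j (φ.symm y) := fun j y hy => by
    have e : χ =ᶠ[𝓝 (φ.symm y)] fun _ => (1 : ℝ) :=
      eventually_nhdsSet_iff_forall.1 hχ1 _ (mem_image_of_mem _ hy)
    simp only [w, partialDeriv_eq_of_eventuallyEq e, e.self_of_nhds]
    simp [partialDeriv]
  have cv : ∀ m, ContDiff ℝ ∞ (mollify m v) := fun m => contDiff_mollify m iv.locallyIntegrable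
  have cw : ∀ j m, ContDiff ℝ ∞ (mollify m (w j)) := fun j m =>
    contDiff_mollify m (iw j).locallyIntegrable
  -- For a mollified function the composite is C¹, so this is the classical chain rule and
  -- integration by parts; both sides then pass to the limit.
  have hm : ∀ m, ∫ y in K, mollify m v (φ.symm y) * partialDeriv i η y =
      -∑ j, ∫ y in K, mollify m (w j) (φ.symm y) *
        (partialDeriv i (fun y => φ.symm y j) y * η y) := fun m => by
    have h1 := (HasWeakDeriv.of_contDiffOn (i := i) hΩ'
      (((cv m).of_le (by simp)).comp_contDiffOn d.contDiffOn_symm)).integral_eq η hη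
    replace h1 := (hset out').symm.trans (h1.trans (congrArg Neg.neg (hset out)))
    rw [← integral_finsetSum]
    · refine h1.trans (congrArg Neg.neg (setIntegral_congr_fun hKc.measurableSet fun y hy => ?_))
      have h2 := partialDeriv_comp (i := i) ((cv m).differentiable (by simp)).differentiableAt
        ((d.contDiffOn_symm.differentiableOn one_ne_zero).differentiableAt (hΩ'.mem_nhds (hK hy)))
      change partialDeriv i (fun y => mollify m v (φ.symm y)) y * η y = _
      rw [h2, Finset.sum_mul]
      simp only [partialDeriv_mollify m (hvw _), mul_assoc]
    · intro j _
      refine ContinuousOn.integrableOn_compact hKc ?_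
      exact ((cw j m).continuous.comp_continuousOn (d.contDiffOn_symm.continuousOn.mono hK)).mul
        (((hψ' j).mono hK).mul hη.continuous.continuousOn)
  have t1 := d.tendsto_setIntegral_comp hK hKc (fun m => (cv m).continuous) iv
    (tendsto_lintegral_mollify_sub iv) (hη.partialDeriv i).continuous.continuousOn
  have t2 := (tendsto_finsetSum Finset.univ fun j _ =>
    d.tendsto_setIntegral_comp hK hKc (fun m => (cw j m).continuous) (iw j)
      (tendsto_lintegral_mollify_sub (iw j))
      (((hψ' j).mono hK).mul hη.continuous.continuousOn)).neg
  simp only [hm] at t1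
  have key := tendsto_nhds_unique t1 t2
  rw [hset out', hset out]
  have k1 : ∫ y in K, f (φ.symm y) * partialDeriv i η y =
      ∫ y in K, v (φ.symm y) * partialDeriv i η y :=
    setIntegral_congr_fun hKc.measurableSet fun y hy => by simp only [ev y hy]
  rw [k1, key, ← integral_finsetSum]
  · refine congrArg Neg.neg (setIntegral_congr_fun hKc.measurableSet fun y hy => ?_)
    simp only [ew _ y hy, Finset.sum_mul, mul_assoc, Pi.mul_apply]
  · intro j _
    have := (hη.integrable_mul (L2 j)).integrableOn (s := K)
    refine this.congr_fun (fun y hy => ?_) hKc.measurableSet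
    simp only [ew j y hy, mul_assoc, Pi.mul_apply]

end diffeo

/-! ### The Sobolev inequality for second derivatives -/

lemma hasDerivAt_along (v : Euc n → ℝ) (x y : Euc n) (r : ℝ)
    (hv : DifferentiableAt ℝ v (x + r • y)) :
    HasDerivAt (fun r : ℝ => v (x + r • y)) (∑ j, partialDeriv j v (x + r • y) * y j) r := by
  have h1 : HasDerivAt (fun r : ℝ => x + r • y) y r := by
    simpa using ((hasDerivAt_id r).smul_const y).const_add x
  have h2 := hv.hasFDerivAt.comp_hasDerivAt r h1
  rwa [fderiv_apply_eq_sum] at h2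

lemma abs_coord_le {y : Euc n} (hy : y ∈ Metric.ball (0 : Euc n) 1) (j : Fin n) : |y j| ≤ 1 := by
  have h := PiLp.norm_apply_le y j
  rw [mem_ball_zero_iff] at hy
  exact h.trans hy.le

/-- Second order Taylor expansion along a segment, as an inequality. -/
lemma enorm_le_taylor {v : Euc n → ℝ} (hv : ContDiff ℝ ∞ v) (x : Euc n) {y : Euc n}
    (hy : y ∈ Metric.ball (0 : Euc n) 1) :
    ‖v x‖ₑ ≤ ‖v (x + y)‖ₑ + ∑ j, ‖partialDeriv j v (x + y)‖ₑ +
      ∫⁻ r in Ioc (0 : ℝ) 1, ENNReal.ofReal r *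
        ∑ j, ∑ k, ‖partialDeriv k (partialDeriv j v) (x + r • y)‖ₑ := by
  have hv1 : ∀ j, ContDiff ℝ ∞ (partialDeriv j v) := fun j => partialDeriv_contDiff hv
  have hv2 : ∀ j k, ContDiff ℝ ∞ (partialDeriv k (partialDeriv j v)) := fun j k =>
    partialDeriv_contDiff (hv1 j)
  set h1 : ℝ → ℝ := fun r => ∑ j, partialDeriv j v (x + r • y) * y j
  set h2 : ℝ → ℝ := fun r => ∑ j, (∑ k, partialDeriv k (partialDeriv j v) (x + r • y) * y k) * y j
  have d1 : ∀ r, HasDerivAt (fun r : ℝ => v (x + r • y)) (h1 r) r := fun r =>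
    hasDerivAt_along v x y r (hv.differentiable (by simp)).differentiableAt
  have d2 : ∀ r, HasDerivAt h1 (h2 r) r := fun r => by
    refine HasDerivAt.fun_sum fun j _ => ?_
    exact (hasDerivAt_along _ x y r
      ((hv1 j).differentiable (by simp)).differentiableAt).mul_const (y j)
  -- Integrating this derivative over [0, 1] is Taylor's formula based at x + y. The factor r it
  -- leaves on the second derivatives compensates part of the singularity r^{-n/q} produced later by
  -- rescaling.
  have d3 : ∀ r, HasDerivAt (fun r => v (x + r • y) - r * h1 r) (-(r * h2 r)) r := fun r => by
    refine ((d1 r).sub ((hasDerivAt_id r).mul (d2 r))).congr_deriv ?_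
    simp only [id]
    ring
  have c2 : Continuous h2 := by
    refine continuous_finsetSum _ fun j _ => (continuous_finsetSum _ fun k _ => ?_).mul
      continuous_const
    exact ((hv2 j k).continuous.comp (by fun_prop)).mul continuous_const
  have ftc := intervalIntegral.integral_eq_sub_of_hasDerivAt (a := 0) (b := 1)
    (fun r _ => d3 r) ((continuous_id.mul c2).neg.intervalIntegrable _ _)
  simp only [one_smul, zero_smul, add_zero, one_mul, zero_mul, sub_zero] at ftc
  rw [intervalIntegral.integral_neg] at ftc
  have key : v x = v (x + y) + -h1 1 + ∫ r in (0 : ℝ)..1, r * h2 r := by linarith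
  have b1 : ‖h1 1‖ₑ ≤ ∑ j, ‖partialDeriv j v (x + y)‖ₑ := by
    simp only [h1, one_smul]
    refine (enorm_sum_le _ _).trans (Finset.sum_le_sum fun j _ => ?_)
    rw [enorm_mul]
    refine mul_le_of_le_one_right' ?_
    rw [Real.enorm_eq_ofReal_abs]
    exact ENNReal.ofReal_le_one.2 (abs_coord_le hy j)
  have b2 : ∀ r, ‖h2 r‖ₑ ≤ ∑ j, ∑ k, ‖partialDeriv k (partialDeriv j v) (x + r • y)‖ₑ := fun r => by
    have one : ∀ j, ‖y j‖ₑ ≤ 1 := fun j => by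
      rw [Real.enorm_eq_ofReal_abs]
      exact ENNReal.ofReal_le_one.2 (abs_coord_le hy j)
    refine (enorm_sum_le _ _).trans (Finset.sum_le_sum fun j _ => ?_)
    rw [enorm_mul]
    refine (mul_le_of_le_one_right' (one j)).trans ?_
    refine (enorm_sum_le _ _).trans (Finset.sum_le_sum fun k _ => ?_)
    rw [enorm_mul]
    exact mul_le_of_le_one_right' (one k)
  rw [key]
  refine (enorm_add_le _ _).trans (add_le_add ((enorm_add_le _ _).trans ?_) ?_)
  · rw [enorm_neg]
    gcongr
  · rw [intervalIntegral.integral_of_le zero_le_one]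
    refine (enorm_integral_le_lintegral_enorm _).trans ?_
    refine lintegral_mono_ae ((ae_restrict_iff' measurableSet_Ioc).2 (ae_of_all _ fun r hr => ?_))
    rw [enorm_mul, Real.enorm_eq_ofReal hr.1.le]
    gcongr
    exact b2 r

lemma lintegral_rpow_Ioc_ne_top {s : ℝ} (hs : -1 < s) :
    ∫⁻ r in Ioc (0 : ℝ) 1, ENNReal.ofReal (r ^ s) ≠ ⊤ := by
  have h := intervalIntegral.intervalIntegrable_rpow' (a := 0) (b := 1) hs
  rw [intervalIntegrable_iff_integrableOn_Ioc_of_le zero_le_one] at h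
  exact h.lintegral_lt_top.ne

/-- Hölder's inequality on the unit ball and rescaling. -/
lemma setLIntegral_ball_comp_le {q : ℝ} (hq1 : 1 ≤ q) {f : Euc n → ℝ} (hf : Continuous f)
    (x : Euc n) {r : ℝ} (hr : 0 < r) :
    ∫⁻ y in Metric.ball (0 : Euc n) 1, ‖f (x + r • y)‖ₑ ≤
      ENNReal.ofReal (r ^ (-((n : ℝ) / q))) * (∫⁻ z, ‖f z‖ₑ ^ q) ^ (1 / q) *
        volume (Metric.ball (0 : Euc n) 1) ^ (1 - 1 / q) := by
  have hq0 : 0 < q := by linarith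
  have hc : Continuous fun y => f (x + r • y) := by fun_prop
  have h1 := eLpNorm'_le_eLpNorm'_mul_rpow_measure_univ
    (μ := volume.restrict (Metric.ball (0 : Euc n) 1)) one_pos hq1 hc.aestronglyMeasurable
  simp only [eLpNorm', ENNReal.rpow_one, div_one, Measure.restrict_apply_univ] at h1
  refine h1.trans (mul_le_mul_left ?_ _)
  have h2 : ∫⁻ y in Metric.ball (0 : Euc n) 1, ‖f (x + r • y)‖ₑ ^ q ≤
      ENNReal.ofReal (r ^ (-(n : ℝ))) * ∫⁻ z, ‖f z‖ₑ ^ q := by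
    refine (lintegral_mono' Measure.restrict_le_self le_rfl).trans_eq ?_
    have h3 : Measurable fun z => ‖f (x + z)‖ₑ ^ q :=
      ((hf.comp (continuous_const.add continuous_id)).measurable.enorm).pow_const q
    have h4 : ∫⁻ y, ‖f (x + r • y)‖ₑ ^ q =
        ∫⁻ z, ‖f (x + z)‖ₑ ^ q ∂Measure.map (fun y : Euc n => r • y) volume :=
      (lintegral_map h3 (measurable_const_smul r)).symm
    rw [h4, Measure.map_addHaar_smul volume hr.ne', lintegral_smul_measure,
      lintegral_add_left_eq_self (fun z => ‖f z‖ₑ ^ q) x, smul_eq_mul, finrank_euclideanSpace_fin,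
      abs_of_pos (by positivity), Real.rpow_neg hr.le, Real.rpow_natCast]
  calc (∫⁻ y in Metric.ball (0 : Euc n) 1, ‖f (x + r • y)‖ₑ ^ q) ^ (1 / q)
      ≤ (ENNReal.ofReal (r ^ (-(n : ℝ))) * ∫⁻ z, ‖f z‖ₑ ^ q) ^ (1 / q) := by gcongr
    _ = _ := by
      rw [ENNReal.mul_rpow_of_nonneg _ _ (by positivity),
        ENNReal.ofReal_rpow_of_nonneg (by positivity) (by positivity), ← Real.rpow_mul hr.le]
      congr 4
      ring

/-- The iterated integral of a function over the segments of the unit ball. -/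
lemma lintegral_segment_le {q s : ℝ} (hq1 : 1 ≤ q) (hs : s = 1 - (n : ℝ) / q) {f : Euc n → ℝ}
    (hf : Continuous f) (x : Euc n) :
    ∫⁻ y in Metric.ball (0 : Euc n) 1, ∫⁻ r in Ioc (0 : ℝ) 1,
        ENNReal.ofReal r * ‖f (x + r • y)‖ₑ ≤
      (∫⁻ r in Ioc (0 : ℝ) 1, ENNReal.ofReal (r ^ s)) *
        volume (Metric.ball (0 : Euc n) 1) ^ (1 - 1 / q) * (∫⁻ z, ‖f z‖ₑ ^ q) ^ (1 / q) := by
  have m3 : Measurable fun p : Euc n × ℝ => ENNReal.ofReal p.2 * ‖f (x + p.2 • p.1)‖ₑ :=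
    measurable_snd.ennreal_ofReal.mul (hf.comp (by fun_prop :
      Continuous fun p : Euc n × ℝ => x + p.2 • p.1)).measurable.enorm
  have swap := lintegral_lintegral_swap (μ := volume.restrict (Metric.ball (0 : Euc n) 1))
    (ν := volume.restrict (Ioc (0 : ℝ) 1))
    (f := fun y r => ENNReal.ofReal r * ‖f (x + r • y)‖ₑ) m3.aemeasurable
  rw [swap, mul_assoc, ← lintegral_mul_const _ (by fun_prop)]
  refine lintegral_mono_ae ((ae_restrict_iff' measurableSet_Ioc).2 (ae_of_all _ fun r hr => ?_))
  have mr : Measurable fun y : Euc n => ‖f (x + r • y)‖ₑ :=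
    (hf.comp (by fun_prop : Continuous fun y : Euc n => x + r • y)).measurable.enorm
  rw [lintegral_const_mul _ mr]
  have hrs : ENNReal.ofReal (r ^ s) =
      ENNReal.ofReal r * ENNReal.ofReal (r ^ (-((n : ℝ) / q))) := by
    rw [← ENNReal.ofReal_mul hr.1.le, hs, sub_eq_add_neg, Real.rpow_add hr.1, Real.rpow_one]
  rw [hrs, mul_assoc]
  refine mul_le_mul_right ((setLIntegral_ball_comp_le hq1 hf x hr.1).trans_eq ?_) _
  ring

/-- The Sobolev inequality `‖v‖_∞ ≤ C ‖v‖_{W^{2,q}}` for `q > n / 2` and smooth `v`. -/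
lemma exists_enorm_le_sobolev {q : ℝ} (hq1 : 1 ≤ q) (hq : (n : ℝ) / 2 < q) :
    ∃ C : ℝ≥0∞, C ≠ ⊤ ∧ ∀ v : Euc n → ℝ, ContDiff ℝ ∞ v → ∀ x,
      volume (Metric.ball (0 : Euc n) 1) * ‖v x‖ₑ ≤ (∫⁻ z, ‖v z‖ₑ) +
        (∑ j, ∫⁻ z, ‖partialDeriv j v z‖ₑ) +
        C * ∑ j, ∑ k, (∫⁻ z, ‖partialDeriv k (partialDeriv j v) z‖ₑ ^ q) ^ (1 / q) := by
  have hq0 : 0 < q := by linarith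
  set B := Metric.ball (0 : Euc n) 1 with hB
  have hBfin : volume B ≠ ⊤ := measure_ball_lt_top.ne
  set s : ℝ := 1 - (n : ℝ) / q with hs
  -- The hypothesis q > n/2 enters here: it is what makes r^{1 - n/q} integrable at 0.
  have hs1 : -1 < s := by
    have : (n : ℝ) / q < 2 := by rw [div_lt_iff₀ hq0]; linarith
    linarith
  have hexp : 0 ≤ 1 - 1 / q := by
    rw [sub_nonneg, div_le_one hq0]; exact hq1
  refine ⟨(∫⁻ r in Ioc (0 : ℝ) 1, ENNReal.ofReal (r ^ s)) * volume B ^ (1 - 1 / q),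
    ENNReal.mul_ne_top (lintegral_rpow_Ioc_ne_top hs1) (ENNReal.rpow_ne_top_of_nonneg hexp hBfin),
    fun v hv x => ?_⟩
  have hv1 : ∀ j, ContDiff ℝ ∞ (partialDeriv j v) := fun j => partialDeriv_contDiff hv
  have hv2 : ∀ j k, ContDiff ℝ ∞ (partialDeriv k (partialDeriv j v)) := fun j k =>
    partialDeriv_contDiff (hv1 j)
  have trans_le : ∀ {f : Euc n → ℝ}, ∫⁻ y in B, ‖f (x + y)‖ₑ ≤ ∫⁻ z, ‖f z‖ₑ := fun {f} =>
    (lintegral_mono' Measure.restrict_le_self le_rfl).trans_eq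
      (lintegral_add_left_eq_self (fun z => ‖f z‖ₑ) x)
  have mt : ∀ {f : Euc n → ℝ}, Continuous f → Measurable fun y => ‖f (x + y)‖ₑ := fun hf =>
    (hf.comp (continuous_const.add continuous_id)).measurable.enorm
  have first : volume B * ‖v x‖ₑ = ∫⁻ _ in B, ‖v x‖ₑ := by
    rw [setLIntegral_const, mul_comm]
  have second : ∫⁻ y in B, ∫⁻ r in Ioc (0 : ℝ) 1, ENNReal.ofReal r *
        ∑ j, ∑ k, ‖partialDeriv k (partialDeriv j v) (x + r • y)‖ₑ ≤
      (∫⁻ r in Ioc (0 : ℝ) 1, ENNReal.ofReal (r ^ s)) * volume B ^ (1 - 1 / q) *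
        ∑ j, ∑ k, (∫⁻ z, ‖partialDeriv k (partialDeriv j v) z‖ₑ ^ q) ^ (1 / q) := by
    have mr : ∀ j k (y : Euc n), Measurable fun r : ℝ =>
        ENNReal.ofReal r * ‖partialDeriv k (partialDeriv j v) (x + r • y)‖ₑ := fun j k y =>
      ENNReal.measurable_ofReal.mul ((hv2 j k).continuous.comp (by fun_prop :
        Continuous fun r : ℝ => x + r • y)).measurable.enorm
    have mp : ∀ j k, Measurable fun y : Euc n => ∫⁻ r in Ioc (0 : ℝ) 1,
        ENNReal.ofReal r * ‖partialDeriv k (partialDeriv j v) (x + r • y)‖ₑ := fun j k =>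
      Measurable.lintegral_prod_right' (f := fun p : Euc n × ℝ =>
        ENNReal.ofReal p.2 * ‖partialDeriv k (partialDeriv j v) (x + p.2 • p.1)‖ₑ)
        (measurable_snd.ennreal_ofReal.mul ((hv2 j k).continuous.comp (by fun_prop :
          Continuous fun p : Euc n × ℝ => x + p.2 • p.1)).measurable.enorm)
    simp only [Finset.mul_sum]
    simp only [lintegral_finsetSum _ fun j _ => Finset.measurable_sum _ fun k _ => mr j k _,
      lintegral_finsetSum _ fun k _ => mr _ k _]
    rw [lintegral_finsetSum _ fun j _ => Finset.measurable_sum _ fun k _ => mp j k]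
    refine Finset.sum_le_sum fun j _ => ?_
    rw [lintegral_finsetSum _ fun k _ => mp j k]
    exact Finset.sum_le_sum fun k _ => lintegral_segment_le hq1 hs (hv2 j k).continuous x
  -- The pointwise Taylor bound is integrated over y in the unit ball, which turns point values at x
  -- + y into L¹ norms.
  calc volume B * ‖v x‖ₑ
      ≤ ∫⁻ y in B, (‖v (x + y)‖ₑ + ∑ j, ‖partialDeriv j v (x + y)‖ₑ +
          ∫⁻ r in Ioc (0 : ℝ) 1, ENNReal.ofReal r *
            ∑ j, ∑ k, ‖partialDeriv k (partialDeriv j v) (x + r • y)‖ₑ) := by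
        rw [first]
        exact lintegral_mono_ae ((ae_restrict_iff' measurableSet_ball).2
          (ae_of_all _ fun y hy => enorm_le_taylor hv x hy))
    _ = (∫⁻ y in B, ‖v (x + y)‖ₑ) + (∑ j, ∫⁻ y in B, ‖partialDeriv j v (x + y)‖ₑ) +
          ∫⁻ y in B, ∫⁻ r in Ioc (0 : ℝ) 1, ENNReal.ofReal r *
            ∑ j, ∑ k, ‖partialDeriv k (partialDeriv j v) (x + r • y)‖ₑ := by
        have ms : Measurable fun y => ∑ j, ‖partialDeriv j v (x + y)‖ₑ :=
          Finset.measurable_sum _ fun j _ => mt (hv1 j).continuous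
        rw [lintegral_add_left (f := fun y => ‖v (x + y)‖ₑ + ∑ j, ‖partialDeriv j v (x + y)‖ₑ)
            ((mt hv.continuous).add ms), lintegral_add_left (mt hv.continuous),
          lintegral_finsetSum _ fun j _ => mt (hv1 j).continuous]
    _ ≤ _ :=
        add_le_add (add_le_add trans_le (Finset.sum_le_sum fun j _ => trans_le)) second

lemma IsTestFunction.memLp_mul {η f : Euc n → ℝ} {p : ℝ≥0∞} (hη : IsTestFunction Ω η)
    (hf : MemLpLoc p Ω f) : MemLp (fun x => η x * f x) p := by
  have hc : IsCompact (tsupport η) := hη.hasCompactSupport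
  obtain ⟨C, -, hC⟩ := hη.exists_bound
  have h1 : MemLp (fun x => η x * f x) p (volume.restrict (tsupport η)) := by
    have h2 := hf _ hη.tsupport_subset hc
    refine (h2.const_mul C).of_le (hη.continuous.aestronglyMeasurable.mul h2.1)
      (ae_of_all _ fun x => ?_)
    rw [norm_mul, norm_mul]
    exact mul_le_mul_of_nonneg_right ((hC x).trans (le_abs_self C)) (norm_nonneg _)
  rw [← memLp_indicator_iff_restrict hc.measurableSet] at h1
  convert! h1 using 1
  ext x
  by_cases hx : x ∈ tsupport η
  · rw [indicator_of_mem hx]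
  · rw [indicator_of_notMem hx, image_eq_zero_of_notMem_tsupport hx, zero_mul]

lemma IsTestFunction.integrable_mul_left {η f : Euc n → ℝ} (hη : IsTestFunction Ω η)
    (hf : LocallyIntegrableOn f Ω) : Integrable (fun x => η x * f x) := by
  simpa [mul_comm] using hη.integrable_mul hf

lemma memLp_ofReal_iff {f : Euc n → ℝ} {q : ℝ} (hq : 0 < q) (hf : AEStronglyMeasurable f) :
    MemLp f (ENNReal.ofReal q) ↔ ∫⁻ x, ‖f x‖ₑ ^ q ≠ ⊤ := by
  rw [MemLp, and_iff_right hf, eLpNorm_lt_top_iff_lintegral_rpow_enorm_lt_top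
    (by simpa using hq) ENNReal.ofReal_ne_top, ENNReal.toReal_ofReal hq.le, lt_top_iff_ne_top]

/-- Functions with weak second derivatives in `L^q`, `q > n / 2`, are bounded. -/
lemma exists_ae_abs_le_of_hasWeakDeriv {q : ℝ} (hq1 : 1 ≤ q) (hq : (n : ℝ) / 2 < q)
    {v : Euc n → ℝ} {w : Fin n → Euc n → ℝ} {z : Fin n → Fin n → Euc n → ℝ}
    (hv : Integrable v) (hw : ∀ j, Integrable (w j))
    (Hv : ∀ j, HasWeakDeriv univ j v (w j)) (Hw : ∀ j k, HasWeakDeriv univ k (w j) (z j k))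
    (hz : ∀ j k, MemLp (z j k) (ENNReal.ofReal q)) : ∃ A, ∀ᵐ x, |v x| ≤ A := by
  have hq0 : 0 < q := by linarith
  obtain ⟨C, hC, hsob⟩ := exists_enorm_le_sobolev (n := n) hq1 hq
  set b := volume (Metric.ball (0 : Euc n) 1)
  have hb0 : b ≠ 0 := (Metric.measure_ball_pos _ _ one_pos).ne'
  have hb1 : b ≠ ⊤ := measure_ball_lt_top.ne
  set A : ℝ≥0∞ := (∫⁻ x, ‖v x‖ₑ) + (∑ j, ∫⁻ x, ‖w j x‖ₑ) +
    C * ∑ j, ∑ k, (∫⁻ x, ‖z j k x‖ₑ ^ q) ^ (1 / q) with hA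
  have hAtop : A ≠ ⊤ := by
    refine ENNReal.add_ne_top.2 ⟨ENNReal.add_ne_top.2 ⟨hv.2.ne, ?_⟩, ENNReal.mul_ne_top hC ?_⟩
    · exact ENNReal.sum_ne_top.2 fun j _ => (hw j).2.ne
    · refine ENNReal.sum_ne_top.2 fun j _ => ENNReal.sum_ne_top.2 fun k _ => ?_
      exact ENNReal.rpow_ne_top_of_nonneg (by positivity)
        ((memLp_ofReal_iff hq0 (hz j k).1).1 (hz j k))
  -- Uniform in m: mollification commutes with weak derivatives and increases neither the L¹ nor the
  -- L^q norm.
  have bound : ∀ m x, b * ‖mollify m v x‖ₑ ≤ A := fun m x => by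
    refine (hsob _ (contDiff_mollify m hv.locallyIntegrable) x).trans ?_
    simp only [partialDeriv_mollify m (Hv _), partialDeriv_mollify m (Hw _ _)]
    refine add_le_add (add_le_add (lintegral_enorm_mollify_le m hv) (Finset.sum_le_sum
      fun j _ => lintegral_enorm_mollify_le m (hw j))) ?_
    refine mul_le_mul_right (Finset.sum_le_sum fun j _ => Finset.sum_le_sum fun k _ => ?_) _
    exact ENNReal.rpow_le_rpow (lintegral_mollify_rpow_le m (hz j k).1 hq1) (by positivity)
  refine ⟨(A / b).toReal, ?_⟩
  filter_upwards [ae_tendsto_mollify hv.locallyIntegrable] with x hx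
  have h1 : ‖v x‖ₑ ≤ A / b := le_of_tendsto hx.enorm (Eventually.of_forall fun m => by
    rw [ENNReal.le_div_iff_mul_le (Or.inl hb0) (Or.inl hb1), mul_comm]
    exact bound m x)
  rw [Real.enorm_eq_ofReal_abs] at h1
  exact (ENNReal.ofReal_le_iff_le_toReal (ENNReal.div_ne_top hAtop hb0)).1 h1

/-! ### Interpolation: first derivatives in L^{2q} -/

lemma hasDerivAt_abs_rpow_mul {s : ℝ} (hs : 0 ≤ s) (t : ℝ) :
    HasDerivAt (fun t : ℝ => |t| ^ s * t) ((s + 1) * |t| ^ s) t := by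
  rcases lt_trichotomy t 0 with ht | rfl | ht
  · have h1 : HasDerivAt (fun t : ℝ => |t|) (-1) t := hasDerivAt_abs_neg ht
    have h2 := (h1.rpow_const (p := s) (Or.inl (abs_pos.2 ht.ne).ne')).mul (hasDerivAt_id t)
    refine h2.congr_deriv ?_
    have h3 : |t| ^ s = |t| ^ (s - 1) * |t| := by
      rw [← Real.rpow_add_one (abs_pos.2 ht.ne).ne']; ring_nf
    simp only [id]
    rw [h3, abs_of_neg ht]
    ring
  · rcases hs.eq_or_lt with rfl | hs
    · simpa using hasDerivAt_id' (0 : ℝ)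
    · rw [hasDerivAt_iff_tendsto_slope_zero]
      have h1 : Tendsto (fun t : ℝ => |t| ^ s) (𝓝[≠] 0) (𝓝 0) := by
        have h2 : Continuous fun t : ℝ => |t| ^ s :=
          continuous_abs.rpow_const fun _ => Or.inr hs.le
        have := h2.tendsto 0
        rw [abs_zero, Real.zero_rpow hs.ne'] at this
        exact this.mono_left nhdsWithin_le_nhds
      rw [abs_zero, Real.zero_rpow hs.ne']
      simp only [mul_zero, zero_add, sub_zero, smul_eq_mul]
      refine h1.congr' ?_
      filter_upwards [self_mem_nhdsWithin] with t ht
      have ht' : t ≠ 0 := ht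
      field_simp
  · have h1 : HasDerivAt (fun t : ℝ => |t|) 1 t := hasDerivAt_abs_pos ht
    have h2 := (h1.rpow_const (p := s) (Or.inl (abs_pos.2 ht.ne').ne')).mul (hasDerivAt_id t)
    refine h2.congr_deriv ?_
    have h3 : |t| ^ s = |t| ^ (s - 1) * |t| := by
      rw [← Real.rpow_add_one (abs_pos.2 ht.ne').ne']; ring_nf
    simp only [id]
    rw [h3, abs_of_pos ht]
    ring

lemma contDiff_abs_rpow_mul {s : ℝ} (hs : 0 ≤ s) : ContDiff ℝ 1 (fun t : ℝ => |t| ^ s * t) := by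
  rw [contDiff_one_iff_deriv]
  refine ⟨fun t => (hasDerivAt_abs_rpow_mul hs t).differentiableAt, ?_⟩
  have : deriv (fun t : ℝ => |t| ^ s * t) = fun t => (s + 1) * |t| ^ s :=
    funext fun t => (hasDerivAt_abs_rpow_mul hs t).deriv
  rw [this]
  exact continuous_const.mul (continuous_abs.rpow_const fun _ => Or.inr hs)

/-- A substitute for Young's inequality: if 2b ≤ a², the first term suffices; otherwise a² is
replaced by 2b. The coefficient 1/2 allows the first term to be absorbed. -/
lemma rpow_mul_le_half_add {q a b : ℝ} (hq : 1 ≤ q) (ha : 0 ≤ a) (hb : 0 ≤ b) :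
    a ^ (2 * q - 2) * b ≤ a ^ (2 * q) / 2 + 2 ^ (q - 1) * b ^ q := by
  rcases le_or_gt (2 * b) (a ^ 2) with h | h
  · have h1 : a ^ (2 * q - 2) * a ^ 2 = a ^ (2 * q) := by
      rw [← Real.rpow_natCast, ← Real.rpow_add_of_nonneg ha (by linarith) (by simp)]
      norm_num
    have h2 : a ^ (2 * q - 2) * (2 * b) ≤ a ^ (2 * q - 2) * a ^ 2 := by gcongr
    have h3 : (0 : ℝ) ≤ 2 ^ (q - 1) * b ^ q := by positivity
    linarith
  · have hb' : 0 < b := by nlinarith [sq_nonneg a]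
    have h1 : a ^ (2 * q - 2) ≤ (2 * b) ^ (q - 1) := by
      have : a ^ (2 * q - 2) = (a ^ 2) ^ (q - 1) := by
        rw [← Real.rpow_natCast, ← Real.rpow_mul ha]
        congr 1
        push_cast
        ring
      rw [this]
      exact Real.rpow_le_rpow (sq_nonneg a) h.le (by linarith)
    have h2 : (2 * b) ^ (q - 1) * b = 2 ^ (q - 1) * b ^ q := by
      rw [Real.mul_rpow two_pos.le hb, mul_assoc, ← Real.rpow_add_one hb'.ne']
      ring_nf
    have h3 : a ^ (2 * q - 2) * b ≤ (2 * b) ^ (q - 1) * b := by gcongr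
    have h4 : (0 : ℝ) ≤ a ^ (2 * q) / 2 := by positivity
    linarith

/-- The interpolation inequality `‖∂ᵢ f‖_{2q}^2 ≤ C ‖f‖_∞ ‖∂ᵢ∂ᵢ f‖_q` for test functions. -/
lemma integral_partialDeriv_rpow_le {q A : ℝ} (hq : 1 ≤ q) {f : Euc n → ℝ}
    (hf : IsTestFunction univ f) (hA : ∀ x, |f x| ≤ A) :
    ∫ x, |partialDeriv i f x| ^ (2 * q) ≤ 2 * 2 ^ (q - 1) * ((2 * q - 1) * A) ^ q *
      ∫ x, |partialDeriv i (partialDeriv i f) x| ^ q := by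
  set w := partialDeriv i f with hw
  set z := partialDeriv i w with hz
  have hwt : IsTestFunction univ w := hf.partialDeriv i
  have hzt : IsTestFunction univ z := hwt.partialDeriv i
  have hA0 : 0 ≤ A := (abs_nonneg _).trans (hA 0)
  have hs : 0 ≤ 2 * q - 2 := by linarith
  have intp : ∀ {g : Euc n → ℝ} {p : ℝ}, IsTestFunction univ g → 0 < p →
      Integrable (fun x => |g x| ^ p) := fun {g p} hg hp => by
    refine (hg.continuous.abs.rpow_const fun _ => Or.inr hp.le).integrable_of_hasCompactSupport ?_
    exact hg.hasCompactSupport.comp_left (g := fun t : ℝ => |t| ^ p)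
      (by simp [Real.zero_rpow hp.ne'])
  -- Write |w|^{2q} = (|w|^{2q-2} w) ∂ᵢf and move the derivative off f, which leaves f itself,
  -- bounded by A.
  have ibp := (HasWeakDeriv.of_contDiffOn (i := i) isOpen_univ
    ((contDiff_abs_rpow_mul hs).comp hwt.contDiff_one).contDiffOn).integral_eq f hf
  have hder : ∀ x, partialDeriv i ((fun t : ℝ => |t| ^ (2 * q - 2) * t) ∘ w) x =
      (2 * q - 1) * |w x| ^ (2 * q - 2) * z x := fun x => by
    have h := (hasDerivAt_abs_rpow_mul hs (w x)).comp_hasFDerivAt x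
      hwt.differentiable.differentiableAt.hasFDerivAt
    rw [partialDeriv, h.fderiv, hz, partialDeriv, smul_apply, smul_eq_mul]
    ring
  have hlhs : ∀ x, ((fun t : ℝ => |t| ^ (2 * q - 2) * t) ∘ w) x * partialDeriv i f x =
      |w x| ^ (2 * q) := fun x => by
    simp only [Function.comp, ← hw]
    rw [mul_assoc, ← abs_mul_abs_self, ← sq, ← Real.rpow_natCast,
      ← Real.rpow_add_of_nonneg (abs_nonneg _) hs (by simp)]
    norm_num
  simp only [hlhs, hder] at ibp
  have i1 := intp hwt (p := 2 * q) (by linarith)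
  have i2 := intp hzt (p := q) (by linarith)
  -- The preceding elementary inequality with b = (2q - 1) A |z|. The integral of |w|^{2q} is finite
  -- because w is a test function, so half of it can be moved to the left.
  have step : ∫ x, |w x| ^ (2 * q) ≤ ∫ x, (|w x| ^ (2 * q) / 2 +
      2 ^ (q - 1) * ((2 * q - 1) * A) ^ q * |z x| ^ q) := by
    rw [ibp, ← integral_neg]
    have hq' : 0 ≤ 2 * q - 1 := by linarith
    have cont : Continuous fun x => (2 * q - 1) * |w x| ^ (2 * q - 2) * z x :=
      (continuous_const.mul (hwt.continuous.abs.rpow_const fun _ => Or.inr hs)).mul hzt.continuous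
    refine integral_mono
      (hf.integrable_mul (cont.locallyIntegrable.locallyIntegrableOn univ)).neg
      ((i1.div_const 2).add (i2.const_mul _)) fun x => ?_
    have h1 := rpow_mul_le_half_add hq (abs_nonneg (w x))
      (b := (2 * q - 1) * A * |z x|) (by positivity)
    rw [Real.mul_rpow (by positivity) (abs_nonneg _), ← mul_assoc (2 ^ (q - 1))] at h1
    refine le_trans ?_ h1
    calc -((2 * q - 1) * |w x| ^ (2 * q - 2) * z x * f x)
        ≤ |(2 * q - 1) * |w x| ^ (2 * q - 2) * z x * f x| := neg_le_abs _
      _ = (2 * q - 1) * |w x| ^ (2 * q - 2) * |z x| * |f x| := by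
        rw [abs_mul, abs_mul, abs_mul, abs_of_nonneg hq',
          abs_of_nonneg (Real.rpow_nonneg (abs_nonneg _) _)]
      _ ≤ (2 * q - 1) * |w x| ^ (2 * q - 2) * |z x| * A := by
        gcongr
        exact hA x
      _ = _ := by ring
  rw [integral_add (i1.div_const 2) (i2.const_mul _), integral_div, integral_const_mul] at step
  linarith

/-- A bounded function with compact support and `∂ᵢ∂ᵢ v ∈ L^q` satisfies `∂ᵢ v ∈ L^{2q}`. -/
lemma memLp_two_mul_of_hasWeakDeriv {q A : ℝ} (hq : 1 ≤ q) {v w z : Euc n → ℝ}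
    (hv : Integrable v) (hw : Integrable w) (hc : HasCompactSupport v)
    (Hv : HasWeakDeriv univ i v w) (Hw : HasWeakDeriv univ i w z)
    (hz : MemLp z (ENNReal.ofReal q)) (hA : ∀ᵐ x, |v x| ≤ A) :
    MemLp w (ENNReal.ofReal (2 * q)) := by
  have hq0 : 0 < q := by linarith
  rw [memLp_ofReal_iff (by linarith) hw.aestronglyMeasurable]
  set c : ℝ := 2 * 2 ^ (q - 1) * ((2 * q - 1) * A) ^ q with hcdef
  have toReal : ∀ {g : Euc n → ℝ} {p : ℝ}, IsTestFunction univ g → 0 < p →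
      ∫⁻ x, ‖g x‖ₑ ^ p = ENNReal.ofReal (∫ x, |g x| ^ p) := fun {g p} hg hp => by
    rw [ofReal_integral_eq_lintegral_ofReal]
    · refine lintegral_congr fun x => ?_
      rw [Real.enorm_eq_ofReal_abs, ENNReal.ofReal_rpow_of_nonneg (abs_nonneg _) hp.le]
    · refine (hg.continuous.abs.rpow_const fun _ => Or.inr hp.le).integrable_of_hasCompactSupport ?_
      exact hg.hasCompactSupport.comp_left (g := fun t : ℝ => |t| ^ p)
        (by simp [Real.zero_rpow hp.ne'])
    · exact ae_of_all _ fun x => Real.rpow_nonneg (abs_nonneg _) _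
  have bound : ∀ m, ∫⁻ x, ‖mollify m w x‖ₑ ^ (2 * q) ≤ ENNReal.ofReal c * ∫⁻ x, ‖z x‖ₑ ^ q := by
    intro m
    have ht : IsTestFunction univ (mollify m v) :=
      ⟨contDiff_mollify m hv.locallyIntegrable, hasCompactSupport_mollify m hc, subset_univ _⟩
    have hb : ∀ x, |mollify m v x| ≤ A := abs_mollify_le m hA
    have hA0 : 0 ≤ A := (abs_nonneg _).trans (hb 0)
    have hc0 : 0 ≤ c := by
      have : 0 ≤ 2 * q - 1 := by linarith
      positivity
    have h1 := integral_partialDeriv_rpow_le (i := i) hq ht hb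
    have ht1 := ht.partialDeriv i
    have ht2 := ht1.partialDeriv i
    simp only [partialDeriv_mollify m Hv, partialDeriv_mollify m Hw] at h1 ht1 ht2
    rw [toReal ht1 (by linarith)]
    refine (ENNReal.ofReal_le_ofReal h1).trans ?_
    rw [ENNReal.ofReal_mul hc0, ← toReal ht2 hq0]
    exact mul_le_mul_right (lintegral_mollify_rpow_le m hz.1 hq) _
  -- Only almost everywhere convergence of the mollifications is available without knowing w ∈
  -- L^{2q}; Fatou's lemma needs no more.
  have fatou : ∫⁻ x, ‖w x‖ₑ ^ (2 * q) ≤ ENNReal.ofReal c * ∫⁻ x, ‖z x‖ₑ ^ q := by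
    calc ∫⁻ x, ‖w x‖ₑ ^ (2 * q)
        = ∫⁻ x, liminf (fun m => ‖mollify m w x‖ₑ ^ (2 * q)) atTop := by
          refine lintegral_congr_ae ?_
          filter_upwards [ae_tendsto_mollify hw.locallyIntegrable] with x hx
          exact ((ENNReal.continuous_rpow_const.tendsto _).comp hx.enorm).liminf_eq.symm
      _ ≤ liminf (fun m => ∫⁻ x, ‖mollify m w x‖ₑ ^ (2 * q)) atTop :=
          lintegral_liminf_le fun m =>
            (contDiff_mollify m hw.locallyIntegrable).continuous.measurable.enorm.pow_const _
      _ ≤ _ := by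
          refine liminf_le_of_le (by isBoundedDefault) fun b hb => ?_
          obtain ⟨m, hm⟩ := hb.exists
          exact hm.trans (bound m)
  exact ne_top_of_le_ne_top
    (ENNReal.mul_ne_top ENNReal.ofReal_ne_top ((memLp_ofReal_iff hq0 hz.1).1 hz)) fatou

/-! ### Local versions of the two embeddings -/

section localization

variable {u : Euc n → ℝ} {χ : Euc n → ℝ} {q : ℝ}

/-- The second weak derivatives of χu, with `uj`, `uk`, `ujk` in the role of the derivatives of u;
this is the input for the estimates on the whole space. -/
lemma HasWeakDeriv.testFunction_mul_deriv {j k : Fin n} {uj uk ujk : Euc n → ℝ}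
    (hχ : IsTestFunction Ω χ) (Hk : HasWeakDeriv Ω k u uk) (Hjk : HasWeakDeriv Ω k uj ujk) :
    HasWeakDeriv univ k (fun x => partialDeriv j χ x * u x + χ x * uj x)
      (fun x => partialDeriv k (partialDeriv j χ) x * u x + partialDeriv j χ x * uk x +
        (partialDeriv k χ x * uj x + χ x * ujk x)) :=
  (Hk.testFunction_mul (hχ.partialDeriv j)).add (Hjk.testFunction_mul hχ)

lemma memLp_testFunction_mul_deriv {j k : Fin n} {uj uk ujk : Euc n → ℝ} {p : ℝ≥0∞}
    (hχ : IsTestFunction Ω χ) (h : MemLpLoc p Ω u) (hk : MemLpLoc p Ω uk) (hj : MemLpLoc p Ω uj)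
    (hjk : MemLpLoc p Ω ujk) :
    MemLp (fun x => partialDeriv k (partialDeriv j χ) x * u x + partialDeriv j χ x * uk x +
        (partialDeriv k χ x * uj x + χ x * ujk x)) p :=
  ((((hχ.partialDeriv j).partialDeriv k).memLp_mul h).add ((hχ.partialDeriv j).memLp_mul hk)).add
    (((hχ.partialDeriv k).memLp_mul hj).add (hχ.memLp_mul hjk))

/-- The embedding `W^{2,q}_loc ⊆ L^∞_loc` for `q > n / 2`. -/
lemma memLpLoc_top_of_hasWeakDeriv (hΩ : IsOpen Ω) (hq1 : 1 ≤ q) (hq : (n : ℝ) / 2 < q)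
    {w : Fin n → Euc n → ℝ} {z : Fin n → Fin n → Euc n → ℝ}
    (hu : LocallyIntegrableOn u Ω) (Hu : ∀ j, HasWeakDeriv Ω j u (w j))
    (Hw : ∀ j k, HasWeakDeriv Ω k (w j) (z j k))
    (lu : MemLpLoc (ENNReal.ofReal q) Ω u) (lw : ∀ j, MemLpLoc (ENNReal.ofReal q) Ω (w j))
    (lz : ∀ j k, MemLpLoc (ENNReal.ofReal q) Ω (z j k)) : MemLpLoc ⊤ Ω u := fun K hK hKc => by
  obtain ⟨χ, hχ, h1⟩ := exists_cutoff hΩ hKc hK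
  obtain ⟨A, hA⟩ := exists_ae_abs_le_of_hasWeakDeriv hq1 hq (v := fun x => χ x * u x)
    (hχ.integrable_mul_left hu)
    (fun j => ((hχ.partialDeriv j).integrable_mul_left hu).add
      (hχ.integrable_mul_left (Hu j).right))
    (fun j => (Hu j).testFunction_mul hχ)
    (fun j k => HasWeakDeriv.testFunction_mul_deriv hχ (Hu k) (Hw j k))
    (fun j k => memLp_testFunction_mul_deriv hχ lu (lw k) (lw j) (lz j k))
  refine memLp_top_of_bound (hu.integrableOn_compact_subset hK hKc).aestronglyMeasurable A ?_
  filter_upwards [ae_restrict_of_ae hA, ae_restrict_mem hKc.measurableSet] with x hx hxK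
  simpa [h1.self_of_nhdsSet x hxK] using hx

/-- If `u ∈ L^∞_loc` and `∂ᵢ∂ᵢ u ∈ L^q_loc`, then `∂ᵢ u ∈ L^{2q}_loc`. -/
lemma memLpLoc_two_mul_of_hasWeakDeriv (hΩ : IsOpen Ω) (hq1 : 1 ≤ q) {w z : Euc n → ℝ}
    (Hu : HasWeakDeriv Ω i u w) (Hw : HasWeakDeriv Ω i w z) (lt : MemLpLoc ⊤ Ω u)
    (lu : MemLpLoc (ENNReal.ofReal q) Ω u) (lw : MemLpLoc (ENNReal.ofReal q) Ω w)
    (lz : MemLpLoc (ENNReal.ofReal q) Ω z) : MemLpLoc (ENNReal.ofReal (2 * q)) Ω w :=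
    fun K hK hKc => by
  obtain ⟨χ, hχ, h1⟩ := exists_cutoff hΩ hKc hK
  obtain ⟨A, hA⟩ : ∃ A, ∀ᵐ x, |χ x * u x| ≤ A := by
    have h := (hχ.memLp_mul lt)
    refine ⟨(eLpNorm (fun x => χ x * u x) ⊤ volume).toReal, ?_⟩
    filter_upwards [ae_le_eLpNormEssSup (f := fun x => χ x * u x) (μ := volume)] with x hx
    rw [← eLpNorm_exponent_top, Real.enorm_eq_ofReal_abs] at hx
    exact (ENNReal.ofReal_le_iff_le_toReal h.2.ne).1 hx
  have key := memLp_two_mul_of_hasWeakDeriv hq1 (hχ.integrable_mul_left Hu.left)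
    (((hχ.partialDeriv i).integrable_mul_left Hu.left).add (hχ.integrable_mul_left Hu.right))
    hχ.hasCompactSupport.mul_right (Hu.testFunction_mul hχ)
    (HasWeakDeriv.testFunction_mul_deriv hχ Hu Hw)
    (memLp_testFunction_mul_deriv hχ lu lw lw lz) hA
  refine (memLp_congr_ae ?_).1 (key.restrict K)
  filter_upwards [ae_restrict_mem hKc.measurableSet] with x hx
  have e : χ =ᶠ[𝓝 x] fun _ => (1 : ℝ) := eventually_nhdsSet_iff_forall.1 h1 x hx
  change partialDeriv i χ x * u x + χ x * w x = w x
  rw [partialDeriv_eq_of_eventuallyEq e, e.self_of_nhds]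
  simp [partialDeriv]

end localization

/-! ### Weighted regularity classes -/

/-- A family of exponents, indexed by a weight, such that Hölder's inequality makes weights
additive up to the total weight `M`. -/
structure IsExponentFamily (M : ℕ) (e : ℕ → ℝ≥0∞) : Prop where
  one_le : ∀ a, 1 ≤ e a
  holder : ∀ a b, a + b ≤ M → (e a)⁻¹ + (e b)⁻¹ ≤ (e (a + b))⁻¹

/-- The function `f` is locally in `L^{e a}` and has `j` orders of weak derivatives, those of
order `m` being locally in `L^{e (a + m)}`. -/
def WeakDiff (e : ℕ → ℝ≥0∞) (Ω : Set (Euc n)) : ℕ → ℕ → (Euc n → ℝ) → Prop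
  | 0, a, f => MemLpLoc (e a) Ω f
  | j + 1, a, f => MemLpLoc (e a) Ω f ∧ ∀ i, ∃ g, HasWeakDeriv Ω i f g ∧ WeakDiff e Ω j (a + 1) g

namespace MemLpLoc

variable {p : ℝ≥0∞} {f g : Euc n → ℝ}

lemma congr_ae (h : MemLpLoc p Ω f) (hfg : f =ᵐ[volume.restrict Ω] g) : MemLpLoc p Ω g :=
  fun K hK hKc => (h K hK hKc).ae_eq (ae_restrict_of_ae_restrict_of_subset hK hfg)

lemma add (hf : MemLpLoc p Ω f) (hg : MemLpLoc p Ω g) : MemLpLoc p Ω (fun x => f x + g x) :=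
  fun K hK hKc => (hf K hK hKc).add (hg K hK hKc)

lemma const_mul (hf : MemLpLoc p Ω f) (c : ℝ) : MemLpLoc p Ω (fun x => c * f x) :=
  fun K hK hKc => (hf K hK hKc).const_mul c

lemma mono_exponent {q : ℝ≥0∞} (hf : MemLpLoc p Ω f) (hq : q ≤ p) : MemLpLoc q Ω f :=
  fun K hK hKc => by
    have : IsFiniteMeasure (volume.restrict K) := ⟨by simpa using hKc.measure_lt_top⟩
    exact (hf K hK hKc).mono_exponent hq

lemma of_continuousOn (hf : ContinuousOn f Ω) : MemLpLoc p Ω f := fun K hK hKc => by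
  have : IsFiniteMeasure (volume.restrict K) := ⟨by simpa using hKc.measure_lt_top⟩
  obtain ⟨C, hC⟩ := hKc.exists_bound_of_continuousOn (hf.mono hK)
  exact MemLp.of_bound ((hf.mono hK).aestronglyMeasurable hKc.measurableSet) C
    ((ae_restrict_iff' hKc.measurableSet).2 (ae_of_all _ hC))

lemma mul {p q r : ℝ≥0∞} (hf : MemLpLoc p Ω f) (hg : MemLpLoc q Ω g) (h : p⁻¹ + q⁻¹ ≤ r⁻¹) :
    MemLpLoc r Ω (fun x => f x * g x) := fun K hK hKc => by
  have : IsFiniteMeasure (volume.restrict K) := ⟨by simpa using hKc.measure_lt_top⟩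
  have : ENNReal.HolderTriple p q (p⁻¹ + q⁻¹)⁻¹ := ⟨by rw [inv_inv]⟩
  have h1 : MemLp (fun x => f x * g x) (p⁻¹ + q⁻¹)⁻¹ (volume.restrict K) :=
    (hg K hK hKc).mul (hf K hK hKc)
  exact h1.mono_exponent (ENNReal.le_inv_iff_le_inv.1 h)

end MemLpLoc

namespace WeakDiff

variable {M j a b : ℕ} {e : ℕ → ℝ≥0∞} {f g : Euc n → ℝ}

lemma memLpLoc (h : WeakDiff e Ω j a f) : MemLpLoc (e a) Ω f := by
  cases j with
  | zero => exact h
  | succ j => exact h.1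

lemma of_succ (h : WeakDiff e Ω (j + 1) a f) : WeakDiff e Ω j a f := by
  induction j generalizing a f with
  | zero => exact h.1
  | succ j ih =>
    refine ⟨h.1, fun i => ?_⟩
    obtain ⟨g, hg, hg'⟩ := h.2 i
    exact ⟨g, hg, ih hg'⟩

lemma mono {j' : ℕ} (h : WeakDiff e Ω j a f) (hj : j' ≤ j) : WeakDiff e Ω j' a f := by
  induction hj with
  | refl => exact h
  | step _ ih => exact ih h.of_succ

lemma congr_ae (hΩ : IsOpen Ω) (h : WeakDiff e Ω j a f) (hfg : f =ᵐ[volume.restrict Ω] g) :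
    WeakDiff e Ω j a g := by
  cases j with
  | zero => exact MemLpLoc.congr_ae h hfg
  | succ j =>
    refine ⟨h.1.congr_ae hfg, fun i => ?_⟩
    obtain ⟨f', H, h'⟩ := h.2 i
    exact ⟨f', H.congr_ae hΩ hfg EventuallyEq.rfl, h'⟩

lemma add (hf : WeakDiff e Ω j a f) (hg : WeakDiff e Ω j a g) :
    WeakDiff e Ω j a (fun x => f x + g x) := by
  induction j generalizing a f g with
  | zero => exact MemLpLoc.add hf hg
  | succ j ih =>
    refine ⟨hf.1.add hg.1, fun i => ?_⟩
    obtain ⟨f', F, hf'⟩ := hf.2 i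
    obtain ⟨g', G, hg'⟩ := hg.2 i
    exact ⟨_, F.add G, ih hf' hg'⟩

lemma const_mul (hf : WeakDiff e Ω j a f) (c : ℝ) : WeakDiff e Ω j a (fun x => c * f x) := by
  induction j generalizing a f with
  | zero => exact MemLpLoc.const_mul hf c
  | succ j ih =>
    refine ⟨hf.1.const_mul c, fun i => ?_⟩
    obtain ⟨f', F, hf'⟩ := hf.2 i
    exact ⟨_, F.const_mul c, ih hf'⟩

lemma zero : WeakDiff e Ω j a (fun _ => 0) := by
  induction j generalizing a with
  | zero => exact MemLpLoc.of_continuousOn continuousOn_const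
  | succ j ih =>
    exact ⟨MemLpLoc.of_continuousOn continuousOn_const, fun i => ⟨_, HasWeakDeriv.zero, ih⟩⟩

lemma const (hΩ : IsOpen Ω) (c : ℝ) : WeakDiff e Ω j a (fun _ => c) := by
  cases j with
  | zero => exact MemLpLoc.of_continuousOn continuousOn_const
  | succ j =>
    refine ⟨MemLpLoc.of_continuousOn continuousOn_const, fun i => ⟨_, ?_, zero⟩⟩
    exact (HasWeakDeriv.of_contDiffOn hΩ contDiffOn_const).congr_eq (fun _ => rfl)
      fun x => by simp [partialDeriv]

lemma sum {ι : Type*} (s : Finset ι) {F : ι → Euc n → ℝ} (h : ∀ k ∈ s, WeakDiff e Ω j a (F k)) :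
    WeakDiff e Ω j a (fun x => ∑ k ∈ s, F k x) := by
  classical
  induction s using Finset.induction_on with
  | empty => simpa using zero
  | insert k s hk ih =>
    simp only [Finset.sum_insert hk]
    exact (h k (by simp)).add (ih fun l hl => h l (by simp [hl]))

/-- In each Leibniz term one factor gains a unit of weight while the number of remaining derivatives
drops by one, so a + b + j is constant along the induction and never exceeds M. Hölder's inequality
supplies the integrability that `HasWeakDeriv.mul` asks for. -/
lemma mul (he : IsExponentFamily M e) (hΩ : IsOpen Ω) (hM : a + b + j ≤ M)
    (hf : WeakDiff e Ω j a f) (hg : WeakDiff e Ω j b g) :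
    WeakDiff e Ω j (a + b) (fun x => f x * g x) := by
  induction j generalizing a b f g with
  | zero => exact MemLpLoc.mul hf hg (he.holder a b hM)
  | succ j ih =>
    have h0 : MemLpLoc (e (a + b)) Ω fun x => f x * g x :=
      hf.1.mul hg.1 (he.holder a b (by omega))
    refine ⟨h0, fun i => ?_⟩
    obtain ⟨f', F, hf'⟩ := hf.2 i
    obtain ⟨g', G, hg'⟩ := hg.2 i
    have h1 : WeakDiff e Ω j (a + b + 1) (fun x => f' x * g x) := by
      rw [add_right_comm]
      exact ih (by omega) hf' hg.of_succ
    have h2 : WeakDiff e Ω j (a + b + 1) (fun x => f x * g' x) :=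
      ih (a := a) (b := b + 1) (by omega) hf.of_succ hg'
    exact ⟨_, F.mul hΩ G (h0.locallyIntegrableOn (he.one_le _) hΩ)
      (h1.memLpLoc.locallyIntegrableOn (he.one_le _) hΩ)
      (h2.memLpLoc.locallyIntegrableOn (he.one_le _) hΩ), h1.add h2⟩

lemma mul_zero_weight (he : IsExponentFamily M e) (hΩ : IsOpen Ω) (hM : a + j ≤ M)
    (hf : WeakDiff e Ω j a f) (hg : WeakDiff e Ω j 0 g) :
    WeakDiff e Ω j a (fun x => f x * g x) :=
  mul (b := 0) he hΩ hM hf hg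

lemma prod (he : IsExponentFamily M e) (hΩ : IsOpen Ω) (hM : j ≤ M) {ι : Type*} (s : Finset ι)
    {F : ι → Euc n → ℝ} (h : ∀ k ∈ s, WeakDiff e Ω j 0 (F k)) :
    WeakDiff e Ω j 0 (fun x => ∏ k ∈ s, F k x) := by
  classical
  induction s using Finset.induction_on with
  | empty => simpa using const hΩ 1
  | insert k s hk ih =>
    simp only [Finset.prod_insert hk]
    exact mul_zero_weight he hΩ (by omega) (h k (by simp)) (ih fun l hl => h l (by simp [hl]))

lemma det (he : IsExponentFamily M e) (hΩ : IsOpen Ω) (hM : j ≤ M)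
    {A : Euc n → Matrix (Fin n) (Fin n) ℝ} (h : ∀ k l, WeakDiff e Ω j 0 (fun x => A x k l)) :
    WeakDiff e Ω j 0 (fun x => (A x).det) := by
  simp only [Matrix.det_apply']
  exact sum _ fun σ _ => (prod he hΩ hM _ fun k _ => h _ _).const_mul _

lemma adjugate (he : IsExponentFamily M e) (hΩ : IsOpen Ω) (hM : j ≤ M)
    {A : Euc n → Matrix (Fin n) (Fin n) ℝ} (h : ∀ k l, WeakDiff e Ω j 0 (fun x => A x k l))
    (k l : Fin n) : WeakDiff e Ω j 0 (fun x => (A x).adjugate k l) := by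
  simp only [Matrix.adjugate_apply]
  refine det he hΩ hM fun k' l' => ?_
  -- An entry of the adjugate is the determinant of the matrix with row l replaced by a constant
  -- unit vector.
  by_cases hk : k' = l
  · subst hk
    simpa using const hΩ _
  · simpa [hk] using h k' l'

/-- Induction through ∂(1/f) = -(1/f)² ∂f, whose right side involves one order less of 1/f.
Continuity and nonvanishing make 1/f locally bounded. -/
lemma inv (he : IsExponentFamily M e) (hΩ : IsOpen Ω) (hM : j ≤ M)
    (hf : WeakDiff e Ω j 0 f) (hc : ContinuousOn f Ω) (h0 : ∀ x ∈ Ω, f x ≠ 0) :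
    WeakDiff e Ω j 0 (fun x => (f x)⁻¹) := by
  have hci : ContinuousOn (fun x => (f x)⁻¹) Ω := hc.inv₀ h0
  induction j with
  | zero => exact MemLpLoc.of_continuousOn hci
  | succ j ih =>
    refine ⟨MemLpLoc.of_continuousOn hci, fun i => ?_⟩
    have hi := ih (by omega) hf.of_succ
    obtain ⟨g, G, hg⟩ := hf.2 i
    refine ⟨_, G.inv hΩ fun K hK hKc => ?_, ?_⟩
    · obtain ⟨C, hC⟩ := hKc.exists_bound_of_continuousOn (hci.mono hK)
      -- C bounds 1/|f| on K; the added 1 keeps the lower bound for |f| well defined and positive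
      -- whatever C is.
      refine ⟨(|C| + 1)⁻¹, by positivity, fun x hx => ?_⟩
      have h1 := hC x hx
      rw [norm_inv, Real.norm_eq_abs] at h1
      exact inv_le_of_inv_le₀ (abs_pos.2 (h0 x (hK hx)))
        (h1.trans ((le_abs_self C).trans (by linarith)))
    · have h1 := mul_zero_weight he hΩ (by omega) hg (mul_zero_weight he hΩ (by omega) hi hi)
      refine (h1.const_mul (-1)).congr_ae hΩ (ae_of_all _ fun x => ?_)
      simp only
      ring

/-- Composition with a diffeomorphism. -/
lemma comp_symm (he : IsExponentFamily M e)
    {φ : OpenPartialHomeomorph (Euc n) (Euc n)} (d : IsC1Diffeomorphism φ Ω Ω') {m : ℕ}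
    (hψ : ∀ i l, WeakDiff e Ω' m 0 (partialDeriv i fun y => φ.symm y l))
    (hM : a + j ≤ M) (hj : j ≤ m + 1) (hf : WeakDiff e Ω j a f) :
    WeakDiff e Ω' j a (fun y => f (φ.symm y)) := by
  induction j generalizing a f with
  | zero => exact d.memLpLoc_comp hf
  | succ j ih =>
    refine ⟨d.memLpLoc_comp hf.1, fun i => ?_⟩
    choose f' F hf' using hf.2
    -- One derivative is already spent, so only j ≤ m orders of the derivatives of the inverse are
    -- needed. This is the gain of one order that drives the bootstrap.
    refine ⟨_, HasWeakDeriv.comp_symm d F i, sum _ fun l _ => ?_⟩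
    exact mul_zero_weight he d.isOpen_right (by omega) (ih (by omega) (by omega) (hf' l))
      ((hψ i l).mono (by omega))

/-- Forgets the improved integrability; for a constant exponent the weight carries no information,
so b is arbitrary. -/
lemma const_exponent {q : ℝ≥0∞} (hq : ∀ b, q ≤ e b) (h : WeakDiff e Ω j a f) :
    WeakDiff (fun _ => q) Ω j b f := by
  induction j generalizing a b f with
  | zero => exact MemLpLoc.mono_exponent h (hq a)
  | succ j ih =>
    refine ⟨h.1.mono_exponent (hq a), fun i => ?_⟩
    obtain ⟨g, G, hg⟩ := h.2 i
    exact ⟨g, G, ih hg⟩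

end WeakDiff

/-! ### The Jacobian of the inverse -/

section inverse

variable {φ : OpenPartialHomeomorph (Euc n) (Euc n)}

/-- The Jacobian matrix. -/
noncomputable def jacobian (φ : Euc n → Euc n) (x : Euc n) : Matrix (Fin n) (Fin n) ℝ :=
  Matrix.of fun l i => partialDeriv i (fun x => φ x l) x

lemma jacobian_mul_jacobian_symm (d : IsC1Diffeomorphism φ Ω Ω') {y : Euc n} (hy : y ∈ Ω') :
    jacobian φ (φ.symm y) * jacobian φ.symm y = 1 := by
  ext l i
  have hx : φ.symm y ∈ Ω := d.mapsTo_symm hy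
  have h1 := partialDeriv_comp (i := i) (v := fun x => φ x l) (ψ := φ.symm) (y := y)
    (((contDiffOn_coord d.contDiffOn l).differentiableOn one_ne_zero).differentiableAt
      (d.isOpen_left.mem_nhds hx))
    ((d.contDiffOn_symm.differentiableOn one_ne_zero).differentiableAt
      (d.isOpen_right.mem_nhds hy))
  have h2 : (fun y => φ (φ.symm y) l) =ᶠ[𝓝 y] fun y => y l := by
    filter_upwards [d.isOpen_right.mem_nhds hy] with z hz
    rw [d.right_inv hz]
  have h3 : partialDeriv i (fun y : Euc n => y l) y = (EuclideanSpace.single i (1 : ℝ)) l := by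
    have : HasFDerivAt (fun y : Euc n => y l) (EuclideanSpace.proj l : Euc n →L[ℝ] ℝ) y :=
      (EuclideanSpace.proj l : Euc n →L[ℝ] ℝ).hasFDerivAt
    rw [partialDeriv, this.fderiv]
    rfl
  rw [partialDeriv_eq_of_eventuallyEq h2, h3] at h1
  rw [Matrix.mul_apply, Matrix.one_apply]
  simp only [jacobian, Matrix.of_apply]
  rw [← h1]
  simp

lemma det_jacobian_ne_zero (d : IsC1Diffeomorphism φ Ω Ω') {x : Euc n} (hx : x ∈ Ω) :
    (jacobian φ x).det ≠ 0 := by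
  have hxs : x ∈ φ.source := d.source_eq ▸ hx
  have hy : φ x ∈ Ω' := d.target_eq ▸ φ.map_source hxs
  have h := congrArg Matrix.det (jacobian_mul_jacobian_symm d hy)
  rw [φ.left_inv hxs, Matrix.det_mul, Matrix.det_one] at h
  exact left_ne_zero_of_mul_eq_one h

/-- Cramer's rule: the right side is a function on Ω, rational in the entries of Dφ, composed with
the inverse. -/
lemma jacobian_symm_apply (d : IsC1Diffeomorphism φ Ω Ω') {y : Euc n} (hy : y ∈ Ω')
    (l i : Fin n) : jacobian φ.symm y l i =
      ((jacobian φ (φ.symm y)).det)⁻¹ * (jacobian φ (φ.symm y)).adjugate l i := by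
  rw [← Matrix.inv_eq_right_inv (jacobian_mul_jacobian_symm d hy), Matrix.inv_def,
    Ring.inverse_eq_inv', Matrix.smul_apply, smul_eq_mul]

lemma continuousOn_det_jacobian (d : IsC1Diffeomorphism φ Ω Ω') :
    ContinuousOn (fun x => (jacobian φ x).det) Ω := by
  simp only [Matrix.det_apply']
  refine continuousOn_finsetSum _ fun σ _ => continuousOn_const.mul
    (continuousOn_finsetProd _ fun k _ => ?_)
  exact continuousOn_partialDeriv d.isOpen_left (contDiffOn_coord d.contDiffOn _)

/-- The derivatives of the inverse are as regular as those of the diffeomorphism. -/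
lemma weakDiff_partialDeriv_symm {M : ℕ} {e : ℕ → ℝ≥0∞} (he : IsExponentFamily M e)
    (d : IsC1Diffeomorphism φ Ω Ω')
    (hφ : ∀ i l, WeakDiff e Ω M 0 (partialDeriv i fun x => φ x l)) {j : ℕ} (hj : j ≤ M)
    (i l : Fin n) : WeakDiff e Ω' j 0 (partialDeriv i fun y => φ.symm y l) := by
  have hΩ := d.isOpen_left
  induction j generalizing i l with
  | zero =>
    exact MemLpLoc.of_continuousOn
      (continuousOn_partialDeriv d.isOpen_right (contDiffOn_coord d.contDiffOn_symm l))
  | succ j ih =>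
    have hJ : ∀ k m, WeakDiff e Ω (j + 1) 0 (fun x => jacobian φ x k m) := fun k m =>
      (hφ m k).mono hj
    have h1 := (WeakDiff.det he hΩ hj hJ).inv he hΩ hj (continuousOn_det_jacobian d)
      fun x hx => det_jacobian_ne_zero d hx
    have h2 := WeakDiff.mul_zero_weight he hΩ (by omega) h1 (WeakDiff.adjugate he hΩ hj hJ l i)
    -- The bootstrap: j orders for the derivatives of the inverse suffice to compose a function
    -- having j + 1 orders.
    have h3 := WeakDiff.comp_symm he d (fun i l => ih (by omega) i l) (by omega) le_rfl h2
    refine h3.congr_ae d.isOpen_right ?_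
    filter_upwards [ae_restrict_mem d.isOpen_right.measurableSet] with y hy
    exact (jacobian_symm_apply d hy l i).symm

end inverse

/-! ### From weak derivatives of order m to successive first order ones -/

lemma iteratedPartialDeriv_zero (α : Fin 0 → Fin n) (η : Euc n → ℝ) (x : Euc n) :
    iteratedPartialDeriv α η x = η x := by
  simp [iteratedPartialDeriv]

/-- The last direction acts first on η. Evaluation at a fixed vector is continuous linear, hence
commutes with the remaining derivatives. -/
lemma iteratedPartialDeriv_snoc {m : ℕ} (α : Fin m → Fin n) (i : Fin n) {η : Euc n → ℝ}
    (hη : ContDiff ℝ ∞ η) (x : Euc n) :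
    iteratedPartialDeriv (Fin.snoc α i : Fin (m + 1) → Fin n) η x =
      iteratedPartialDeriv α (partialDeriv i η) x := by
  rw [iteratedPartialDeriv, iteratedPartialDeriv, iteratedFDeriv_succ_apply_right]
  have h1 : ContDiff ℝ m (fun y => fderiv ℝ η y) := hη.fderiv_right (by exact_mod_cast le_top)
  have h2 : partialDeriv i η =
      (ContinuousLinearMap.apply ℝ ℝ (EuclideanSpace.single i (1 : ℝ)) :
        (Euc n →L[ℝ] ℝ) →L[ℝ] ℝ) ∘ fun y => fderiv ℝ η y := rfl
  rw [h2, ContinuousLinearMap.iteratedFDeriv_comp_left _ h1.contDiffAt le_rfl]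
  simp only [ContinuousLinearMap.compContinuousMultilinearMap_coe, Function.comp_apply,
    ContinuousLinearMap.apply_apply, Fin.snoc_last]
  congr 2
  ext j
  simp [Fin.init]

lemma isTestFunction_iteratedPartialDeriv {m : ℕ} (α : Fin m → Fin n) {η : Euc n → ℝ}
    (hη : IsTestFunction Ω η) : IsTestFunction Ω (iteratedPartialDeriv α η) := by
  induction m generalizing η with
  | zero =>
    have : iteratedPartialDeriv α η = η := funext (iteratedPartialDeriv_zero α η)
    rwa [this]
  | succ m ih =>
    have : iteratedPartialDeriv α η =
        iteratedPartialDeriv (Fin.init α) (partialDeriv (α (Fin.last m)) η) := by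
      ext x
      rw [← iteratedPartialDeriv_snoc _ _ hη.contDiff, Fin.snoc_init_self]
    rw [this]
    exact ih _ (hη.partialDeriv _)

lemma setIntegral_mul_testFunction {f η : Euc n → ℝ} (hη : IsTestFunction Ω η) :
    ∫ x in Ω, f x * η x = ∫ x, f x * η x :=
  setIntegral_eq_integral_of_forall_compl_eq_zero fun x hx => by
    rw [hη.zero_of_notMem hx, mul_zero]

lemma hasWeakPartialDeriv_iff {m : ℕ} {α : Fin m → Fin n} {u g : Euc n → ℝ} :
    HasWeakPartialDeriv Ω α u g ↔ LocallyIntegrableOn u Ω ∧ LocallyIntegrableOn g Ω ∧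
      ∀ η, IsTestFunction Ω η →
        ∫ x, u x * iteratedPartialDeriv α η x = (-1 : ℝ) ^ m * ∫ x, g x * η x := by
  refine and_congr_right fun _ => and_congr_right fun _ => ⟨fun h η hη => ?_, fun h η h1 h2 h3 => ?_⟩
  · have := h η hη.contDiff hη.hasCompactSupport hη.tsupport_subset
    rwa [setIntegral_mul_testFunction hη,
      setIntegral_mul_testFunction (isTestFunction_iteratedPartialDeriv α hη)] at this
  · have hη : IsTestFunction Ω η := ⟨h1, h2, h3⟩
    rw [setIntegral_mul_testFunction hη,
      setIntegral_mul_testFunction (isTestFunction_iteratedPartialDeriv α hη)]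
    exact h η hη

lemma hasWeakPartialDeriv_zero {u : Euc n → ℝ} (hu : LocallyIntegrableOn u Ω)
    (α : Fin 0 → Fin n) : HasWeakPartialDeriv Ω α u u :=
  hasWeakPartialDeriv_iff.2 ⟨hu, hu, fun η _ => by simp [iteratedPartialDeriv_zero]⟩

/-- The identity of order m tested with ∂ᵢη and the identity of order m + 1 tested with η have the
same left side; cancelling (-1)^m leaves the first order identity. -/
lemma hasWeakDeriv_of_hasWeakPartialDeriv {m : ℕ} {α : Fin m → Fin n} {u g h : Euc n → ℝ}
    (H : HasWeakPartialDeriv Ω α u g)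
    (H' : HasWeakPartialDeriv Ω (Fin.snoc α i : Fin (m + 1) → Fin n) u h) :
    HasWeakDeriv Ω i g h := by
  rw [hasWeakPartialDeriv_iff] at H H'
  refine ⟨H.2.1, H'.2.1, fun η hη => ?_⟩
  have h1 := H.2.2 _ (hη.partialDeriv i)
  have h2 := H'.2.2 η hη
  simp only [iteratedPartialDeriv_snoc _ _ hη.contDiff] at h2
  rw [h1, pow_succ, mul_assoc] at h2
  have := mul_left_cancel₀ (pow_ne_zero m (by norm_num : (-1 : ℝ) ≠ 0)) h2
  rw [this]
  ring

lemma HasWeakDeriv.hasWeakPartialDeriv_snoc {m : ℕ} {α : Fin m → Fin n} {u g h : Euc n → ℝ}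
    (H : HasWeakPartialDeriv Ω α u g) (H' : HasWeakDeriv Ω i g h) :
    HasWeakPartialDeriv Ω (Fin.snoc α i : Fin (m + 1) → Fin n) u h := by
  rw [hasWeakPartialDeriv_iff] at H ⊢
  refine ⟨H.1, H'.right, fun η hη => ?_⟩
  simp only [iteratedPartialDeriv_snoc _ _ hη.contDiff]
  rw [H.2.2 _ (hη.partialDeriv i), H'.integral_eq η hη]
  ring

/-! ### Sobolev exponents and conclusion -/

/-- The exponents `∞, …, ∞, 2q, q` provided by the Sobolev embedding. -/
noncomputable def sobolevExponent (M : ℕ) (q : ℝ) (a : ℕ) : ℝ≥0∞ :=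
  if a + 2 ≤ M then ⊤ else if a + 1 ≤ M then ENNReal.ofReal (2 * q) else ENNReal.ofReal q

lemma le_sobolevExponent (M : ℕ) {q : ℝ} (hq : 1 ≤ q) (a : ℕ) :
    ENNReal.ofReal q ≤ sobolevExponent M q a := by
  unfold sobolevExponent
  split_ifs
  · exact le_top
  · exact ENNReal.ofReal_le_ofReal (by linarith)
  · exact le_rfl

/-- Weight 0 has exponent ∞ because M ≥ 2, so it is harmless. For positive weights, a + b = M leaves
both exponents at least 2q, and 1/(2q) + 1/(2q) = 1/q; a + b < M leaves both equal to ∞. -/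
lemma isExponentFamily_sobolevExponent {M : ℕ} (hM : 2 ≤ M) {q : ℝ} (hq : 1 ≤ q) :
    IsExponentFamily M (sobolevExponent M q) := by
  have hadd : (ENNReal.ofReal (2 * q))⁻¹ + (ENNReal.ofReal (2 * q))⁻¹ = (ENNReal.ofReal q)⁻¹ := by
    rw [ENNReal.ofReal_mul zero_le_two, ENNReal.mul_inv (by simp) (by simp), ENNReal.ofReal_ofNat,
      ← add_mul, ENNReal.inv_two_add_inv_two, one_mul]
  refine ⟨fun a => (ENNReal.one_le_ofReal.2 hq).trans (le_sobolevExponent M hq a),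
    fun a b hab => ?_⟩
  have top : ∀ a, a + 2 ≤ M → (sobolevExponent M q a)⁻¹ = 0 := fun a ha => by
    simp [sobolevExponent, ha]
  rcases Nat.eq_zero_or_pos a with rfl | ha
  · rw [top 0 (by omega), zero_add, zero_add]
  rcases Nat.eq_zero_or_pos b with rfl | hb
  · rw [top 0 (by omega), add_zero, add_zero]
  have half : ∀ a, a + 1 ≤ M → (sobolevExponent M q a)⁻¹ ≤ (ENNReal.ofReal (2 * q))⁻¹ := by
    intro a ha
    unfold sobolevExponent
    split_ifs <;> simp
  by_cases hab' : a + b = M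
  · have : sobolevExponent M q (a + b) = ENNReal.ofReal q := by
      simp [sobolevExponent, hab']
    rw [this, ← hadd]
    exact add_le_add (half a (by omega)) (half b (by omega))
  · rw [top a (by omega), top b (by omega), add_zero]
    exact zero_le

lemma MemLpLoc.of_memLp {p : ℝ≥0∞} {f : Euc n → ℝ} (h : MemLp f p (volume.restrict Ω)) :
    MemLpLoc p Ω f := fun _ hK _ => h.mono_measure (Measure.restrict_mono hK le_rfl)

/-- The weak derivatives of a Sobolev function lie in the spaces given by the Sobolev embedding. -/
lemma exists_weakDiff_of_memSobolev {M : ℕ} {q : ℝ} (hq1 : 1 ≤ q)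
    (hq : (n : ℝ) / 2 < q) (hΩ : IsOpen Ω) {u : Euc n → ℝ} (hu : MemSobolev (M + 1) q Ω u)
    (hM : 2 ≤ M) : ∀ i, ∃ g, HasWeakDeriv Ω i u g ∧ WeakDiff (sobolevExponent M q) Ω M 0 g := by
  choose! G HG LG using hu.2
  have lq : ∀ m ≤ M + 1, ∀ α : Fin m → Fin n, MemLpLoc (ENNReal.ofReal q) Ω (G m α) :=
    fun m hm α => MemLpLoc.of_memLp (LG m hm α)
  have H : ∀ m, m + 1 ≤ M + 1 → ∀ (α : Fin m → Fin n) i,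
      HasWeakDeriv Ω i (G m α) (G (m + 1) (Fin.snoc α i : Fin (m + 1) → Fin n)) := fun m hm α i =>
    hasWeakDeriv_of_hasWeakPartialDeriv (HG m (by omega) α) (HG (m + 1) hm _)
  have ltop : ∀ m, m + 2 ≤ M + 1 → ∀ α : Fin m → Fin n, MemLpLoc ⊤ Ω (G m α) := fun m hm α =>
    memLpLoc_top_of_hasWeakDeriv hΩ hq1 hq (HG m (by omega) α).2.1 (H m (by omega) α)
      (fun j k => H (m + 1) (by omega) _ k) (lq m (by omega) α) (fun j => lq _ (by omega) _)
      (fun j k => lq _ (by omega) _)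
  have lhalf : ∀ α : Fin M → Fin n, MemLpLoc (ENNReal.ofReal (2 * q)) Ω (G M α) := by
    obtain ⟨M, rfl⟩ : ∃ M', M = M' + 1 := ⟨M - 1, by omega⟩
    intro α
    have h1 := H M (by omega) (Fin.init α) (α (Fin.last M))
    rw [Fin.snoc_init_self] at h1
    -- The interpolation needs only an unmixed second derivative, so the last direction of α is used
    -- twice, on the derivative of u along the other directions, which is locally bounded.
    exact memLpLoc_two_mul_of_hasWeakDeriv hΩ hq1 h1 (H (M + 1) le_rfl α (α (Fin.last M)))
      (ltop M (by omega) _) (lq M (by omega) _) (lq (M + 1) (by omega) α) (lq (M + 2) (by omega) _)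
  -- Weights count from the first derivatives: weight a belongs to order a + 1.
  have le : ∀ a, a + 1 ≤ M + 1 → ∀ α : Fin (a + 1) → Fin n,
      MemLpLoc (sobolevExponent M q a) Ω (G (a + 1) α) := fun a ha α => by
    unfold sobolevExponent
    split_ifs with h1 h2
    · exact ltop _ (by omega) α
    · obtain rfl : M = a + 1 := by omega
      exact lhalf α
    · exact lq _ ha α
  have tower : ∀ j a, a + 1 + j ≤ M + 1 → ∀ α : Fin (a + 1) → Fin n,
      WeakDiff (sobolevExponent M q) Ω j a (G (a + 1) α) := by
    intro j
    induction j with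
    | zero => exact fun a ha α => le a (by omega) α
    | succ j ih =>
      exact fun a ha α => ⟨le a (by omega) α, fun i => ⟨_, H (a + 1) (by omega) α i,
        ih (a + 1) (by omega) _⟩⟩
  intro i
  have hloc : LocallyIntegrableOn u Ω := (HG 0 (by omega) Fin.elim0).1
  exact ⟨_, hasWeakDeriv_of_hasWeakPartialDeriv (hasWeakPartialDeriv_zero hloc Fin.elim0)
    (HG 1 (by omega) _), tower M 0 (by omega) _⟩

/-- Derivatives are built by appending one direction at a time, and local integrability on the
compact closure of V gives integrability on V. -/
lemma memSobolev_of_weakDiff {k : ℕ} {q : ℝ} (hq1 : 1 ≤ q) (hΩ : IsOpen Ω) {u : Euc n → ℝ}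
    (hu : WeakDiff (fun _ => ENNReal.ofReal q) Ω k 0 u) : MemSobolevLoc k q Ω u := by
  intro V _ hVc hVΩ
  have memV : ∀ {g : Euc n → ℝ}, MemLpLoc (ENNReal.ofReal q) Ω g →
      MemLp g (ENNReal.ofReal q) (volume.restrict V) := fun hg =>
    (hg _ hVΩ hVc).mono_measure (Measure.restrict_mono subset_closure le_rfl)
  have hVΩ' : V ⊆ Ω := subset_closure.trans hVΩ
  have key : ∀ m ≤ k, ∀ α : Fin m → Fin n, ∃ g, HasWeakPartialDeriv V α u g ∧
      WeakDiff (fun _ => ENNReal.ofReal q) Ω (k - m) 0 g := by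
    intro m
    induction m with
    | zero =>
      intro _ α
      exact ⟨u, hasWeakPartialDeriv_zero ((hu.memLpLoc.locallyIntegrableOn
        (ENNReal.one_le_ofReal.2 hq1) hΩ).mono_set hVΩ') α, hu⟩
    | succ m ih =>
      intro hm α
      obtain ⟨g, hg, hg'⟩ := ih (by omega) (Fin.init α)
      obtain ⟨j, hj⟩ : ∃ j, k - m = j + 1 := ⟨k - m - 1, by omega⟩
      rw [hj] at hg'
      obtain ⟨h, H, hh⟩ := hg'.2 (α (Fin.last m))
      refine ⟨h, ?_, ?_⟩
      · have := HasWeakDeriv.hasWeakPartialDeriv_snoc hg (H.mono hVΩ')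
        rwa [Fin.snoc_init_self] at this
      · obtain rfl : k - (m + 1) = j := by omega
        exact hh.const_exponent fun _ => le_rfl
  refine ⟨memV hu.memLpLoc, fun m hm α => ?_⟩
  obtain ⟨g, hg, hg'⟩ := key m hm α
  exact ⟨g, hg, memV hg'.memLpLoc⟩

end SobolevInverse

open SobolevInverse in
theorem mainTheorem11 (n k : ℕ) (q : ℝ) (hk : 3 ≤ k) (hq1 : 1 ≤ q) (hq : (n : ℝ) / 2 < q)
    (Ω Ω' : Set (EuclideanSpace ℝ (Fin n)))
    (hΩ : IsBoundedSmoothDomain Ω) (hΩ' : IsBoundedSmoothDomain Ω')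
    (φ : OpenPartialHomeomorph (EuclideanSpace ℝ (Fin n)) (EuclideanSpace ℝ (Fin n)))
    (hφ : IsC1Diffeomorphism φ Ω Ω') (hφW : MemSobolevMap k q Ω Ω' φ) :
    MemSobolevMapLoc k q Ω' Ω φ.symm := by
  obtain ⟨M, rfl⟩ : ∃ M, k = M + 1 := ⟨k - 1, by omega⟩
  have he := isExponentFamily_sobolevExponent (M := M) (by omega) hq1
  have hJ : ∀ i l, WeakDiff (sobolevExponent M q) Ω M 0 (partialDeriv i fun x => φ x l) :=
    fun i l => by
      obtain ⟨g, Hg, hg⟩ :=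
        exists_weakDiff_of_memSobolev hq1 hq hΩ.isOpen (hφW.2 l) (by omega) i
      -- Cramer's rule uses classical partial derivatives; uniqueness identifies them with the weak
      -- ones.
      exact hg.congr_ae hΩ.isOpen
        (Hg.unique hΩ.isOpen (.of_contDiffOn hΩ.isOpen (contDiffOn_coord hφ.contDiffOn l)))
  refine ⟨hφ.mapsTo_symm, fun l => memSobolev_of_weakDiff hq1 hΩ'.isOpen
    ⟨MemLpLoc.of_continuousOn (contDiffOn_coord hφ.contDiffOn_symm l).continuousOn,
      fun i => ⟨_, .of_contDiffOn hΩ'.isOpen (contDiffOn_coord hφ.contDiffOn_symm l), ?_⟩⟩⟩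
  exact (weakDiff_partialDeriv_symm he hφ hJ le_rfl i l).const_exponent (le_sobolevExponent M hq1)
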